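/- Let $\Sigma=\{0,1,\dots,\sigma-1\}$ and let $T[1,n]\in\Sigma^n$, $n\ge 2$, $\sigma\le n$, be a text, i.e. its last character is the smallest character $\$=0$ and $\$$ occurs nowhere else in $T$. Let $\overline T=T[n-1]\cdots T[1]\,\$$, and let $\mathrm{SA}$, $\mathrm{LCP}$ and $\mathrm{BWT}$ be the suffix array, the longest-common-prefix array and the Burrows--Wheeler transform of $\overline T$: $\mathrm{SA}$ lists the positions $1,\dots,n$ in the lexicographic order of the suffixes of $\overline T$ starting there, $\mathrm{LCP}[i]$ ($2\le i\le n$) is the length of the longest common prefix of the suffixes starting at $\mathrm{SA}[i-1]$ and $\mathrm{SA}[i]$, and $\mathrm{BWT}[i]=\overline T[\mathrm{SA}[i]-1]$ with $\overline T[0]=\$$. Let $\bar r$ be the number of runs (maximal blocks of equal characters) of $\mathrm{BWT}$. A string $\beta$ is right-maximal in $T$ if it is a suffix of $T$ or if $\beta a$ and $\beta b$ are both substrings of $T$ for two distinct characters $a,b$. A set $S\subseteq\{1,\dots,n\}$ is suffixient for $T$ if for all $1\le i\le j\le n$ such that $T[i,j-1]$ is right-maximal there is $x\in S$ such that $T[i,j]$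 is a suffix of $T[1,x]$. The one-pass algorithm maintains a set $\mathcal S$, a value $m$, and an entry $R[c]=(\mathit{len},\mathit{pos},\mathit{active})$ for each $c\in\Sigma$. The procedure $\mathrm{eval}(l)$ does the following for each $c\in\Sigma$ with $l<R[c].\mathit{len}$: if $R[c].\mathit{active}$, add $R[c].\mathit{pos}$ to $\mathcal S$; then set $R[c]\gets(l,0,\mathit{false})$. Initially $\mathcal S=\emptyset$, $m=\infty$ and $R[c]=(-1,0,\mathit{false})$ for all $c$. For $i=2,\dots,n$: set $m\gets\min\{m,\mathrm{LCP}[i]\}$; if $\mathrm{BWT}[i]\ne\mathrm{BWT}[i-1]$, then call $\mathrm{eval}(m)$, next for $i'=i-1$ and $i'=i$ set $R[\mathrm{BWT}[i']]\gets(\mathrm{LCP}[i],\,n-\mathrm{SA}[i']+1,\,\mathit{true})$ provided that $\mathrm{LCP}[i]>R[\mathrm{BWT}[i']].\mathit{len}$, and finally set $m\gets\infty$. After the loop call $\mathrm{eval}(-1)$ and return $\mathcal S$. Then the set $\mathcal S$ returned by the one-pass algorithm is a suffixient set of smallest cardinality for $T$. Moreover, the algorithm can be implemented in $O(n+\bar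 r\log\sigma)$ time and $O(n)$ words of space with a single streaming pass: there are one word-RAM program and one constant $C$ such that, for all $\sigma$ and $T$ as above, the program, given $n$ and $\sigma$ and the triples $(\mathrm{BWT}[i],\mathrm{LCP}[i],\mathrm{SA}[i])$, $i=1,\dots,n$ (where $\mathrm{LCP}[1]$ is the placeholder $0$), as a read-once left-to-right input stream, outputs the elements of $\mathcal S$, each exactly once, and halts after at most $C\,(n+\bar r\log_2\sigma)$ unit-cost steps, using at most $C\,n$ memory cells and a constant number of registers, all of which hold only integers in $[0,C\,n)$. -/

import Mathlib

namespace Suffixient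

/-! ### Texts, suffix array, LCP array, Burrows-Wheeler transform

Strings are lists; text positions are 1-based, so `T[i..j]` is `(T.take j).drop (i - 1)`. -/

/-- A text over the ordered alphabet `Fin σ`: a string of length at least 2 whose last character is
the smallest character `$` (the one of value `0`), which occurs nowhere else. -/
def IsText {σ : ℕ} (T : List (Fin σ)) : Prop :=
  2 ≤ T.length ∧ ∃ (u : List (Fin σ)) (d : Fin σ), T = u ++ [d] ∧ (d : ℕ) = 0 ∧ d ∉ u

/-- The reverse `T[n-1] ⋯ T[1] T[n]` of a text, which keeps the end marker at the end. -/
def revText {α : Type*} (T : List α) : List α :=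
  T.dropLast.reverse ++ T.getLast?.toList

/-- The suffix of `w` that starts at the (1-based) position `k`. -/
def suffixAt {α : Type*} (w : List α) (k : ℕ) : List α :=
  w.drop (k - 1)

/-- The suffix array: the positions `1, …, |w|`, sorted by the lexicographic order of the suffixes
that start there. -/
def suffixArray {α : Type*} [LinearOrder α] (w : List α) : List ℕ :=
  (List.range' 1 w.length).insertionSort (fun i j => suffixAt w i ≤ suffixAt w j)

/-- Length of the longest common prefix of two strings. -/
def lcpLen {α : Type*} [DecidableEq α] : List α → List α → ℕ
  | a :: u, b :: v => if a = b then lcpLen u v + 1 else 0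
  | _, _ => 0

/-- The LCP array. Its first entry, which the usual definition leaves undefined, is the placeholder
`0`; the entry of index `i ≥ 2` is the length of the longest common prefix of the `(i-1)`-th and
the `i`-th smallest suffix. -/
def lcpArray {α : Type*} [LinearOrder α] (w : List α) : List ℕ :=
  0 :: List.zipWith (fun k l => lcpLen (suffixAt w k) (suffixAt w l))
    (suffixArray w) (suffixArray w).tail

/-- The Burrows-Wheeler transform: the character cyclically preceding each suffix, the suffixes
being taken in lexicographic order. (The 1-based position `k - 1` is the list index `k - 2`.) -/
def bwt {α : Type*} [LinearOrder α] (w : List α) : List α :=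
  (suffixArray w).filterMap (fun k => if k = 1 then w.getLast? else w[k - 2]?)

/-- The number of runs (maximal blocks of equal characters) of a string. -/
def runs {α : Type*} [DecidableEq α] (w : List α) : ℕ :=
  (w.splitBy (fun a b => a == b)).length

/-- The number of runs of the Burrows-Wheeler transform of the reversed text. -/
def rBar {α : Type*} [LinearOrder α] (T : List α) : ℕ :=
  runs (bwt (revText T))

/-- The triples `(BWT[i], LCP[i], SA[i])`, `i = 1, …, n`, of the reversed text. -/
def arrays {α : Type*} [LinearOrder α] (T : List α) : List (α × ℕ × ℕ) :=
  (bwt (revText T)).zip ((lcpArray (revText T)).zip (suffixArray (revText T)))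

/-! ### Suffixient sets -/

/-- `β` is a right-maximal substring of `T`: it is a suffix of `T`, or it can be extended to the
right within `T` by two distinct characters. -/
def RightMaximal {α : Type*} (T β : List α) : Prop :=
  β <:+ T ∨ ∃ a b : α, a ≠ b ∧ (β ++ [a]) <:+: T ∧ (β ++ [b]) <:+: T

/-- `S ⊆ [n]` is suffixient for `T`: each one-character right-extension `T[i..j]` of a right-maximal
string `T[i..j-1]` is a suffix of `T[1..x]` for some `x ∈ S`. -/
def IsSuffixient {α : Type*} (T : List α) (S : Finset ℕ) : Prop :=
  S ⊆ Finset.Icc 1 T.length ∧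
    ∀ i j : ℕ, 1 ≤ i → i ≤ j → j ≤ T.length →
      RightMaximal T ((T.take (j - 1)).drop (i - 1)) →
        ∃ x ∈ S, (T.take j).drop (i - 1) <:+ T.take x

/-- A suffixient set of smallest cardinality. -/
def IsSmallestSuffixient {α : Type*} (T : List α) (S : Finset ℕ) : Prop :=
  IsSuffixient T S ∧ ∀ S' : Finset ℕ, IsSuffixient T S' → S.card ≤ S'.card

/-! ### The one-pass algorithm -/

/-- An entry of the table `R`. -/
structure Candidate where
  len : ℤ
  pos : ℕ
  active : Bool

/-- The variables of the one-pass algorithm; `m = none` stands for `m = ∞`. -/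
structure OnePassState (σ : ℕ) where
  S : Finset ℕ
  R : Fin σ → Candidate
  m : Option ℕ

/-- The procedure `eval(Σ, l, R, 𝒮)`. The iterations of its loop over the characters `c ∈ Σ` touch
disjoint entries of `R`, and so are performed simultaneously. -/
def eval {σ : ℕ} (l : ℤ) (st : OnePassState σ) : OnePassState σ :=
  { S := st.S ∪ (Finset.univ.filter
      (fun c => l < (st.R c).len ∧ (st.R c).active = true)).image (fun c => (st.R c).pos)
    R := fun c => if l < (st.R c).len then ⟨l, 0, false⟩ else st.R c
    m := st.m }

/-- `if lcp > R[c].len then R[c] ← (lcp, pos, true)`. -/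
def activate {σ : ℕ} (lcp pos : ℕ) (c : Fin σ) (st : OnePassState σ) : OnePassState σ :=
  if (st.R c).len < (lcp : ℤ) then
    { st with R := Function.update st.R c ⟨lcp, pos, true⟩ }
  else st

/-- The body of the main loop for an index `i`, given the triples of index `i - 1` and `i`. -/
def onePassStep {σ : ℕ} (n : ℕ) (st : OnePassState σ)
    (p : (Fin σ × ℕ × ℕ) × (Fin σ × ℕ × ℕ)) : OnePassState σ :=
  match p with
  | ((b', _, s'), (b, l, s)) =>
    let m : ℕ := match st.m with
      | none => l
      | some k => min k l
    if b ≠ b' then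
      { activate l (n - s + 1) b (activate l (n - s' + 1) b' (eval (m : ℤ) st)) with m := none }
    else
      { st with m := some m }

/-- The initial values of the variables. -/
def onePassInit (σ : ℕ) : OnePassState σ :=
  { S := ∅, R := fun _ => ⟨-1, 0, false⟩, m := none }

/-- The set returned by the one-pass algorithm on the text `T`. -/
def onePass {σ : ℕ} (T : List (Fin σ)) : Finset ℕ :=
  (eval (-1) (((arrays T).zip (arrays T).tail).foldl
    (onePassStep T.length) (onePassInit σ))).S

/-! ### A streaming word RAM

A program works on finitely many registers and on a random access memory. Its input is a one-way
stream of triples of numbers, which can only be read from left to right, each triple once; its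
output is a one-way stream of numbers. -/

/-- Programs; `x`, `y`, `z` are names of registers. -/
inductive Prog where
  /-- do nothing -/
  | skip
  /-- `x := k` for a constant `k` -/
  | const (x k : ℕ)
  /-- `x := y` -/
  | copy (x y : ℕ)
  /-- `x := y + z` -/
  | add (x y z : ℕ)
  /-- `x := y - z` (truncated at `0`) -/
  | sub (x y z : ℕ)
  /-- `x := memory[y]` -/
  | load (x y : ℕ)
  /-- `memory[x] := y` -/
  | store (x y : ℕ)
  /-- read the next triple of the input stream into `x`, `y`, `z` -/
  | read (x y z : ℕ)
  /-- append the content of `x` to the output stream -/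
  | write (x : ℕ)
  | seq (p q : Prog)
  /-- `if x < y then p else q` -/
  | ite (x y : ℕ) (p q : Prog)
  /-- `while x < y do p` -/
  | loop (x y : ℕ) (p : Prog)

structure State where
  reg : ℕ → ℕ
  mem : ℕ → ℕ
  inp : List (ℕ × ℕ × ℕ)
  out : List ℕ

def State.set (s : State) (x v : ℕ) : State :=
  { s with reg := Function.update s.reg x v }

/-- `Exec W M p s t s'`: on a machine with `M` memory cells (of addresses `0, …, M - 1`) and words
that hold the numbers `0, …, W - 1`, program `p`, started in state `s`, halts in state `s'` after
exactly `t` steps. Each instruction and each test counts as one step. There is no execution if a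
number that does not fit a word is produced or read, if an address outside of the memory is used, or
if the program reads beyond the end of the input stream. -/
inductive Exec (W M : ℕ) : Prog → State → ℕ → State → Prop where
  | skip (s : State) : Exec W M .skip s 1 s
  | const (s : State) (x k : ℕ) (h : k < W) : Exec W M (.const x k) s 1 (s.set x k)
  | copy (s : State) (x y : ℕ) : Exec W M (.copy x y) s 1 (s.set x (s.reg y))
  | add (s : State) (x y z : ℕ) (h : s.reg y + s.reg z < W) :
      Exec W M (.add x y z) s 1 (s.set x (s.reg y + s.reg z))
  | sub (s : State) (x y z : ℕ) : Exec W M (.sub x y z) s 1 (s.set x (s.reg y - s.reg z))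
  | load (s : State) (x y : ℕ) (h : s.reg y < M) :
      Exec W M (.load x y) s 1 (s.set x (s.mem (s.reg y)))
  | store (s : State) (x y : ℕ) (h : s.reg x < M) :
      Exec W M (.store x y) s 1 { s with mem := Function.update s.mem (s.reg x) (s.reg y) }
  | read (s : State) (x y z a b c : ℕ) (rest : List (ℕ × ℕ × ℕ)) (h : s.inp = (a, b, c) :: rest)
      (ha : a < W) (hb : b < W) (hc : c < W) :
      Exec W M (.read x y z) s 1 { ((s.set x a).set y b).set z c with inp := rest }
  | write (s : State) (x : ℕ) : Exec W M (.write x) s 1 { s with out := s.out ++ [s.reg x] }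
  | seq (p q : Prog) (s s' s'' : State) (t t' : ℕ) (hp : Exec W M p s t s')
      (hq : Exec W M q s' t' s'') : Exec W M (.seq p q) s (t + t') s''
  | ite_true (x y : ℕ) (p q : Prog) (s s' : State) (t : ℕ) (h : s.reg x < s.reg y)
      (hp : Exec W M p s t s') : Exec W M (.ite x y p q) s (t + 1) s'
  | ite_false (x y : ℕ) (p q : Prog) (s s' : State) (t : ℕ) (h : ¬ s.reg x < s.reg y)
      (hq : Exec W M q s t s') : Exec W M (.ite x y p q) s (t + 1) s'
  | loop_true (x y : ℕ) (p : Prog) (s s' s'' : State) (t t' : ℕ) (h : s.reg x < s.reg y)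
      (hp : Exec W M p s t s') (hl : Exec W M (.loop x y p) s' t' s'') :
      Exec W M (.loop x y p) s (t + t' + 1) s''
  | loop_false (x y : ℕ) (p : Prog) (s : State) (h : ¬ s.reg x < s.reg y) :
      Exec W M (.loop x y p) s 1 s

/-- The initial state on the text `T`: registers `0` and `1` hold the text length and the alphabet
size, all other registers and the memory are zero, the input stream carries the triples
`(BWT[i], LCP[i], SA[i])` of the reversed text for `i = 1, …, n`, characters being represented by
their ranks `0, …, σ - 1`, and the output stream is empty. -/
def initState {σ : ℕ} (T : List (Fin σ)) : State where
  reg := fun x => if x = 0 then T.length else if x = 1 then σ else 0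
  mem := fun _ => 0
  inp := (arrays T).map (fun p => ((p.1 : ℕ), p.2.1, p.2.2))
  out := []

end Suffixient

namespace Suffixient

/-! ### Longest common prefixes of sorted strings -/

section Strings

variable {α : Type*}

theorem le_lcpLen_iff [DecidableEq α] (l : ℕ) (u v : List α) :
    l ≤ lcpLen u v ↔ l ≤ u.length ∧ l ≤ v.length ∧ u.take l = v.take l := by
  induction l generalizing u v with
  | zero => simp
  | succ l ih =>
    cases u with
    | nil => simp [lcpLen]
    | cons a u =>
      cases v with
      | nil => simp [lcpLen]
      | cons b v =>
        by_cases h : a = b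
        · simp [lcpLen, h, ih]
        · simp [lcpLen, h]

theorem list_cons_le_cons_iff [LinearOrder α] {a b : α} {u v : List α} :
    a :: u ≤ b :: v ↔ a < b ∨ a = b ∧ u ≤ v := by
  rw [← not_lt, List.cons_lt_cons_iff, ← not_lt (a := v)]
  rcases lt_trichotomy a b with h | rfl | h
  · simp [h, h.not_gt, h.ne']
  · simp
  · simp [h, h.not_gt, h.ne']

theorem lcpLen_of_le_of_le [LinearOrder α] {u v w : List α} (huv : u ≤ v) (hvw : v ≤ w) :
    lcpLen u w = min (lcpLen u v) (lcpLen v w) := by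
  induction u generalizing v w with
  | nil => simp [lcpLen]
  | cons a u ih =>
    cases v with
    | nil => exact absurd List.Lex.nil huv.not_gt
    | cons b v =>
      cases w with
      | nil => exact absurd List.Lex.nil hvw.not_gt
      | cons c w =>
        rw [list_cons_le_cons_iff] at huv hvw
        rcases huv with h1 | ⟨rfl, h1⟩
        · have h3 : a ≠ c := by
            rcases hvw with h2 | ⟨rfl, -⟩
            · exact (h1.trans h2).ne
            · exact h1.ne
          simp [lcpLen, h1.ne, h3]
        · rcases hvw with h2 | ⟨rfl, h2⟩
          · simp [lcpLen, h2.ne]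
          · simp [lcpLen, ih h1 h2]

/-- The prefixes of lengths `y` and `y'` of `T` have a common suffix of length `l`. -/
def SufEq (T : List α) (l y y' : ℕ) : Prop :=
  l ≤ y ∧ l ≤ y' ∧ (T.take y).drop (y - l) = (T.take y').drop (y' - l)

theorem SufEq.symm {T : List α} {l y y' : ℕ} (h : SufEq T l y y') : SufEq T l y' y :=
  ⟨h.2.1, h.1, h.2.2.symm⟩

theorem SufEq.trans {T : List α} {l y y' y'' : ℕ} (h : SufEq T l y y') (h' : SufEq T l y' y'') :
    SufEq T l y y'' :=
  ⟨h.1, h'.2.1, h.2.2.trans h'.2.2⟩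

theorem SufEq.refl {T : List α} {l y : ℕ} (h : l ≤ y) : SufEq T l y y :=
  ⟨h, h, rfl⟩

theorem SufEq.mono {T : List α} {l m y y' : ℕ} (h : SufEq T l y y') (hm : m ≤ l) :
    SufEq T m y y' := by
  obtain ⟨h1, h2, h3⟩ := h
  refine ⟨hm.trans h1, hm.trans h2, ?_⟩
  have := congrArg (List.drop (l - m)) h3
  rw [List.drop_drop, List.drop_drop] at this
  rwa [show y - m = y - l + (l - m) by omega, show y' - m = y' - l + (l - m) by omega]

theorem revText_append (u : List α) (d : α) : revText (u ++ [d]) = u.reverse ++ [d] := by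
  simp [revText]

theorem suffixAt_revText (u : List α) (d : α) {k : ℕ} (h1 : 1 ≤ k) (h2 : k ≤ u.length + 1) :
    suffixAt (revText (u ++ [d])) k = (u.take (u.length + 1 - k)).reverse ++ [d] := by
  rw [revText_append, suffixAt, List.drop_append_of_le_length (by simp; omega), List.drop_reverse]
  congr 3
  omega

theorem le_lcpLen_reverse_take_iff [DecidableEq α] {u : List α} {d : α} (hd : d ∉ u) {y y' : ℕ}
    (hy : y ≤ u.length) (hy' : y' ≤ u.length) (hne : y ≠ y') (l : ℕ) :
    l ≤ lcpLen ((u.take y).reverse ++ [d]) ((u.take y').reverse ++ [d]) ↔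
      SufEq (u ++ [d]) l y y' := by
  have key : l ≤ y → l ≤ y' →
      (((u.take y).reverse ++ [d]).take l = ((u.take y').reverse ++ [d]).take l ↔
        ((u ++ [d]).take y).drop (y - l) = ((u ++ [d]).take y').drop (y' - l)) := by
    intro h1 h2
    rw [List.take_append_of_le_length (by simp; omega),
      List.take_append_of_le_length (by simp; omega), List.take_reverse, List.take_reverse,
      List.take_append_of_le_length hy, List.take_append_of_le_length hy', List.reverse_inj]
    simp [hy, hy']
  have aux : ∀ {y y' : ℕ}, y ≤ u.length → y' ≤ u.length → y < y' →
      ((u.take y).reverse ++ [d]).take (y + 1) ≠ ((u.take y').reverse ++ [d]).take (y + 1) := by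
    intro y y' hy hy' hlt h
    rw [List.take_append_of_le_length (i := y + 1) (l₁ := (u.take y').reverse)
      (by simp; omega), List.take_of_length_le (by simp)] at h
    have h2 : d ∈ ((u.take y').reverse).take (y + 1) := by rw [← h]; simp
    exact hd (List.mem_of_mem_take (List.mem_reverse.1 (List.mem_of_mem_take h2)))
  rw [le_lcpLen_iff, SufEq]
  constructor
  · rintro ⟨h1, h2, h3⟩
    simp only [List.length_append, List.length_reverse, List.length_take, List.length_singleton,
      min_eq_left hy, min_eq_left hy'] at h1 h2
    have h4 : l ≤ y := by
      by_contra hc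
      obtain rfl : l = y + 1 := by omega
      exact aux hy hy' (by omega) h3
    have h5 : l ≤ y' := by
      by_contra hc
      obtain rfl : l = y' + 1 := by omega
      exact aux hy' hy (by omega) h3.symm
    exact ⟨h4, h5, (key h4 h5).1 h3⟩
  · rintro ⟨h4, h5, h3⟩
    refine ⟨?_, ?_, (key h4 h5).2 h3⟩ <;>
      simp only [List.length_append, List.length_reverse, List.length_take, List.length_singleton,
        min_eq_left hy, min_eq_left hy'] <;> omega

end Strings

/-! ### The arrays of the reversed text -/

/-- The functions `b`, `L` and `s` list the Burrows-Wheeler transform, the LCP array and the suffix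
array of the reverse of `T`, with indices starting from `0`. -/
structure IsArrays {α : Type*} (T : List α) (b : ℕ → α) (L s : ℕ → ℕ) : Prop where
  one_le : ∀ k < T.length, 1 ≤ s k
  le_length : ∀ k < T.length, s k ≤ T.length
  inj : ∀ k < T.length, ∀ k' < T.length, s k = s k' → k = k'
  surj : ∀ y, 1 ≤ y → y ≤ T.length → ∃ k < T.length, s k = y
  getElem? : ∀ k < T.length, T[T.length - s k]? = some (b k)
  lcp_iff : ∀ k k', k < k' → k' < T.length → ∀ l,
    (∀ t, k < t → t ≤ k' → l ≤ L t) ↔ SufEq T l (T.length - s k) (T.length - s k')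

theorem length_suffixArray {α : Type*} [LinearOrder α] (w : List α) :
    (suffixArray w).length = w.length := by
  simp [suffixArray]

theorem le_lcpLen_iff_forall {α : Type*} [LinearOrder α] (f : ℕ → List α) (n : ℕ)
    (hf : ∀ i j, i ≤ j → j < n → f i ≤ f j) (k k' : ℕ) (h : k < k') (hk' : k' < n) (l : ℕ) :
    (∀ t, k < t → t ≤ k' → l ≤ lcpLen (f (t - 1)) (f t)) ↔ l ≤ lcpLen (f k) (f k') := by
  induction k', h using Nat.le_induction with
  | base =>
    constructor
    · intro H; simpa using H (k + 1) (by omega) le_rfl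
    · intro H t h1 h2
      obtain rfl : t = k + 1 := by omega
      simpa using H
  | succ m hm ih =>
    rw [lcpLen_of_le_of_le (hf k m (by omega) (by omega)) (hf m (m + 1) (by omega) hk'), le_min_iff,
      ← ih (by omega)]
    constructor
    · intro H
      exact ⟨fun t h1 h2 => H t h1 (by omega), by simpa using H (m + 1) (by omega) le_rfl⟩
    · rintro ⟨H1, H2⟩ t h1 h2
      rcases Nat.lt_or_ge m t with h3 | h3
      · obtain rfl : t = m + 1 := by omega
        simpa using H2
      · exact H1 t h1 h3

theorem exists_isArrays {σ : ℕ} {T : List (Fin σ)} (hT : IsText T) :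
    ∃ (b : ℕ → Fin σ) (L s : ℕ → ℕ), IsArrays T b L s ∧
      arrays T = (List.range T.length).map (fun k => (b k, L k, s k)) ∧
      bwt (revText T) = (List.range T.length).map b := by
  obtain ⟨-, u, d, rfl, -, hd⟩ := hT
  set w := revText (u ++ [d]) with hw
  have hwr : w = u.reverse ++ [d] := revText_append u d
  have hwl : w.length = u.length + 1 := by simp [hwr]
  have hTl : (u ++ [d]).length = u.length + 1 := by simp
  set sa := suffixArray w with hsa
  have hsal : sa.length = u.length + 1 := by rw [hsa, length_suffixArray, hwl]
  have hperm : sa.Perm (List.range' 1 (u.length + 1)) := by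
    rw [← hwl]; exact List.perm_insertionSort _ _
  have hsort : sa.Pairwise (fun i j => suffixAt w i ≤ suffixAt w j) := by
    have : Std.Total (fun i j : ℕ => suffixAt w i ≤ suffixAt w j) := ⟨fun i j => le_total _ _⟩
    have : IsTrans ℕ (fun i j : ℕ => suffixAt w i ≤ suffixAt w j) :=
      ⟨fun i j k => le_trans⟩
    exact List.pairwise_insertionSort _ _
  have hnd : sa.Nodup := hperm.nodup_iff.2 List.nodup_range'
  have hmem : ∀ x, x ∈ sa ↔ 1 ≤ x ∧ x ≤ u.length + 1 := by
    intro x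
    rw [hperm.mem_iff, List.mem_range'_1]
    omega
  let s : ℕ → ℕ := fun k => sa.getD k 0
  have hs : ∀ k (h : k < sa.length), s k = sa[k] := fun k h => by simp [s, h]
  let c : ℕ → Fin σ := fun x => (u ++ [d]).getD (u.length + 1 - x) d
  let L : ℕ → ℕ := fun k => (lcpArray w).getD k 0
  have hsmem : ∀ k < u.length + 1, 1 ≤ s k ∧ s k ≤ u.length + 1 := by
    intro k hk
    rw [hs k (by omega), ← hmem]
    exact List.getElem_mem _
  have hsinj : ∀ k < u.length + 1, ∀ k' < u.length + 1, s k = s k' → k = k' := by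
    intro k hk k' hk' h
    rw [hs k (by omega), hs k' (by omega)] at h
    exact (hnd.getElem_inj_iff).1 h
  have hsamap : sa = (List.range (u.length + 1)).map s := by
    apply List.ext_getElem
    · simp [hsal]
    · intro i h1 h2
      simp [hs i h1]
  have hbwt : bwt w = (List.range (u.length + 1)).map (fun k => c (s k)) := by
    have : bwt w = sa.map c := by
      rw [bwt, List.filterMap_eq_map_iff_forall_eq_some]
      intro x hx
      rw [hmem] at hx
      split_ifs with h
      · subst h
        simp [hwr, c]
      · rw [hwr, List.getElem?_append_left (by simp; omega), List.getElem?_reverse (by omega)]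
        have h3 : u.length + 1 - x < u.length := by omega
        simp only [c, List.getD_eq_getElem?_getD]
        rw [List.getElem?_append_left h3, List.getElem?_eq_getElem h3]
        simp only [Option.getD_some]
        rw [List.getElem?_eq_getElem (by omega)]
        congr 2
        omega
    rw [this, hsamap, List.map_map]
    rfl
  have hLsucc : ∀ k, 0 < k → k < u.length + 1 →
      L k = lcpLen (suffixAt w (s (k - 1))) (suffixAt w (s k)) := by
    intro k h0 hk
    obtain ⟨k, rfl⟩ : ∃ j, k = j + 1 := ⟨k - 1, by omega⟩
    have h1 : k < (List.zipWith (fun k l => lcpLen (suffixAt w k) (suffixAt w l))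
        sa sa.tail).length := by simp [hsal]; omega
    simp only [L, lcpArray, List.getD_cons_succ, ← hsa]
    rw [List.getD_eq_getElem _ _ h1, List.getElem_zipWith]
    rw [hs (k + 1) (by omega), Nat.add_sub_cancel, hs k (by omega)]
    simp
  have hLlen : (lcpArray w).length = u.length + 1 := by
    simp [lcpArray, ← hsa, hsal]
  have hLmap : lcpArray w = (List.range (u.length + 1)).map L := by
    apply List.ext_getElem
    · simp [hLlen]
    · intro i h1 h2
      simp [L, h1]
  refine ⟨fun k => c (s k), L, s, ⟨?_, ?_, ?_, ?_, ?_, ?_⟩, ?_, ?_⟩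
  · intro k hk; exact (hsmem k (hTl ▸ hk)).1
  · intro k hk; rw [hTl]; exact (hsmem k (hTl ▸ hk)).2
  · rw [hTl]; exact hsinj
  · intro y h1 h2
    rw [hTl] at h2 ⊢
    obtain ⟨k, hk, rfl⟩ := List.mem_iff_getElem.1 ((hmem y).2 ⟨h1, h2⟩)
    exact ⟨k, by omega, hs k hk⟩
  · intro k hk
    have := hsmem k (hTl ▸ hk)
    rw [hTl]
    simp only [c]
    rw [List.getD_eq_getElem _ _ (by rw [hTl]; omega), List.getElem?_eq_getElem]
  · intro k k' h1 h2 l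
    rw [hTl] at h2 ⊢
    have hmono : ∀ i j, i ≤ j → j < u.length + 1 → suffixAt w (s i) ≤ suffixAt w (s j) := by
      intro i j hij hj
      rcases hij.eq_or_lt with rfl | hij
      · exact le_rfl
      · rw [hs i (by omega), hs j (by omega)]
        exact List.pairwise_iff_getElem.1 hsort i j _ _ hij
    have hk := hsmem k (by omega)
    have hk' := hsmem k' (by omega)
    have hne : s k ≠ s k' := fun h => by
      have := hsinj k (by omega) k' h2 h
      omega
    rw [← le_lcpLen_reverse_take_iff hd (by omega) (by omega) (by omega),
      ← suffixAt_revText u d hk.1 hk.2, ← suffixAt_revText u d hk'.1 hk'.2,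
      ← le_lcpLen_iff_forall (fun i => suffixAt w (s i)) _ hmono k k' h1 h2]
    refine forall_congr' fun t => forall_congr' fun h3 => forall_congr' fun h4 => ?_
    rw [hLsucc t (by omega) (by omega)]
  · rw [arrays, ← hw, ← hsa, hbwt, hLmap, hsamap, hTl]
    apply List.ext_getElem
    · simp
    · intro i h1 h2
      simp
  · rw [hTl, hbwt]

theorem IsArrays.lcp_lt {α : Type*} {T : List α} {b : ℕ → α} {L s : ℕ → ℕ} (h : IsArrays T b L s)
    {k : ℕ} (h0 : 0 < k) (hk : k < T.length) : L k < T.length := by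
  have h1 := (h.lcp_iff (k - 1) k (by omega) hk (L k)).1 (fun t h1 h2 => by
    obtain rfl : t = k := by omega
    exact le_rfl)
  have := h1.2.1
  have := h.one_le k hk
  omega

/-! ### The algorithm with eager evaluation

Calling `eval` in every iteration, instead of accumulating the minimum `m` until the next run
boundary, gives the same result and needs no variable `m`. -/

section Eager

variable {σ : ℕ}

/-- The effect of `eval(l)` on one entry of the table. -/
def evalEntry (l : ℤ) (r : Candidate) : Candidate :=
  if l < r.len then ⟨l, 0, false⟩ else r

theorem eval_R (l : ℤ) (st : OnePassState σ) (c : Fin σ) :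
    (eval l st).R c = evalEntry l (st.R c) := rfl

theorem mem_eval_S {l : ℤ} {st : OnePassState σ} {x : ℕ} :
    x ∈ (eval l st).S ↔
      x ∈ st.S ∨ ∃ c, l < (st.R c).len ∧ (st.R c).active = true ∧ (st.R c).pos = x := by
  simp [eval, and_assoc]

theorem eval_eval (l l' : ℤ) (st : OnePassState σ) :
    eval l (eval l' st) = eval (min l' l) st := by
  have hR : (eval l (eval l' st)).R = (eval (min l' l) st).R := by
    funext c
    simp only [eval_R, evalEntry]
    by_cases h1 : l' < (st.R c).len
    · by_cases h2 : l < l'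
      · have := h2.trans h1
        simp [h1, h2, h2.le, this]
      · simp [h1, h2, min_eq_left (not_lt.1 h2)]
    · by_cases h2 : l < (st.R c).len
      · have : l ≤ l' := by omega
        simp [h1, h2, this]
      · simp [h1, h2]
  have hS : (eval l (eval l' st)).S = (eval (min l' l) st).S := by
    ext x
    simp only [mem_eval_S, eval_R, evalEntry]
    constructor
    · rintro ((h | ⟨c, h1, h2, h3⟩) | ⟨c, h1, h2, h3⟩)
      · exact Or.inl h
      · exact Or.inr ⟨c, (min_le_left _ _).trans_lt h1, h2, h3⟩
      · split_ifs at h1 h2 h3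
        exact Or.inr ⟨c, (min_le_right _ _).trans_lt h1, h2, h3⟩
    · rintro (h | ⟨c, h1, h2, h3⟩)
      · exact Or.inl (Or.inl h)
      · by_cases h4 : l' < (st.R c).len
        · exact Or.inl (Or.inr ⟨c, h4, h2, h3⟩)
        · refine Or.inr ⟨c, ?_⟩
          rw [if_neg h4]
          exact ⟨(min_lt_iff.1 h1).resolve_left h4, h2, h3⟩
  have hm : (eval l (eval l' st)).m = (eval (min l' l) st).m := rfl
  cases h1 : eval l (eval l' st)
  cases h2 : eval (min l' l) st
  simp_all

theorem activate_R (l p : ℕ) (c c' : Fin σ) (st : OnePassState σ) :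
    (activate l p c st).R c' =
      if c' = c ∧ (st.R c).len < (l : ℤ) then ⟨l, p, true⟩ else st.R c' := by
  unfold activate
  by_cases h : (st.R c).len < (l : ℤ)
  · by_cases hc : c' = c
    · subst hc; simp [h]
    · simp [h, hc]
  · simp [h]

theorem activate_S (l p : ℕ) (c : Fin σ) (st : OnePassState σ) :
    (activate l p c st).S = st.S := by
  unfold activate; split_ifs <;> rfl

variable (b : ℕ → Fin σ) (L p : ℕ → ℕ)

/-- The body of the main loop with eager evaluation, for the index `i`, where `p` gives the text
positions. -/
def eagerStep (i : ℕ) (st : OnePassState σ) : OnePassState σ :=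
  if b i ≠ b (i - 1) then
    activate (L i) (p i) (b i) (activate (L i) (p (i - 1)) (b (i - 1)) (eval (L i) st))
  else eval (L i) st

/-- The state after the iteration for the index `i`. -/
def eagerState : ℕ → OnePassState σ
  | 0 => onePassInit σ
  | i + 1 => eagerStep b L p (i + 1) (eagerState i)

/-- Perform the delayed evaluation. -/
def settle (st : OnePassState σ) : OnePassState σ :=
  match st.m with
  | none => st
  | some k => eval k st

theorem settle_R_S_step (n : ℕ) (s : ℕ → ℕ) (i : ℕ) (st : OnePassState σ) (e : OnePassState σ)
    (hR : (settle st).R = e.R) (hS : (settle st).S = e.S) :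
    let st' := onePassStep n st ((b i, L i, s i), (b (i + 1), L (i + 1), s (i + 1)))
    let e' := eagerStep b L (fun k => n - s k + 1) (i + 1) e
    (settle st').R = e'.R ∧ (settle st').S = e'.S := by
  have key : (eval ((match st.m with | none => L (i + 1) | some k => min k (L (i + 1)) : ℕ) : ℤ)
      st).R = (eval (L (i + 1)) e).R ∧
      (eval ((match st.m with | none => L (i + 1) | some k => min k (L (i + 1)) : ℕ) : ℤ) st).S =
        (eval (L (i + 1)) e).S := by
    have h1 : eval ((match st.m with | none => L (i + 1) | some k => min k (L (i + 1)) : ℕ) : ℤ)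
        st = eval (L (i + 1)) (settle st) := by
      unfold settle
      cases st.m with
      | none => rfl
      | some k => simp only [eval_eval, Nat.cast_min]
    rw [h1]
    simp only [eval, hR, hS, and_self]
  have hact : ∀ (l q : ℕ) (c : Fin σ) (x y : OnePassState σ), x.R = y.R → x.S = y.S →
      (activate l q c x).R = (activate l q c y).R ∧
        (activate l q c x).S = (activate l q c y).S := by
    intro l q c x y h1 h2
    refine ⟨?_, by simp only [activate_S, h2]⟩
    funext c'
    simp only [activate_R, h1]
  simp only [onePassStep, eagerStep, Nat.add_sub_cancel]
  split_ifs with h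
  · have h1 := hact (L (i + 1)) (n - s i + 1) (b i) _ _ key.1 key.2
    exact hact (L (i + 1)) (n - s (i + 1) + 1) (b (i + 1)) _ _ h1.1 h1.2
  · exact key

theorem onePass_eq_eager {T : List (Fin σ)} {s : ℕ → ℕ}
    (h : arrays T = (List.range T.length).map (fun k => (b k, L k, s k))) :
    onePass T =
      (eval (-1) (eagerState b L (fun k => T.length - s k + 1) (T.length - 1))).S := by
  have hz : (arrays T).zip (arrays T).tail = (List.range (T.length - 1)).map
      (fun i => ((b i, L i, s i), (b (i + 1), L (i + 1), s (i + 1)))) := by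
    rw [h]
    apply List.ext_getElem
    · simp
    · intro i h1 h2
      simp
  have main : ∀ i, ∃ st, st = ((List.range i).map
      (fun i => ((b i, L i, s i), (b (i + 1), L (i + 1), s (i + 1))))).foldl
        (onePassStep T.length) (onePassInit σ) ∧
      (settle st).R = (eagerState b L (fun k => T.length - s k + 1) i).R ∧
      (settle st).S = (eagerState b L (fun k => T.length - s k + 1) i).S := by
    intro i
    induction i with
    | zero => exact ⟨_, rfl, rfl, rfl⟩
    | succ i ih =>
      obtain ⟨st, h1, h2, h3⟩ := ih
      refine ⟨_, rfl, ?_⟩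
      rw [List.range_succ, List.map_append, List.foldl_append, ← h1]
      exact settle_R_S_step b L T.length s i st _ h2 h3
  obtain ⟨st, h1, h2, h3⟩ := main (T.length - 1)
  rw [onePass, hz, ← h1]
  have h4 : (eval (-1) (settle st)).S = (eval (-1) st).S := by
    unfold settle
    cases st.m with
    | none => rfl
    | some k =>
      simp only [eval_eval]
      rw [min_eq_right (by omega)]
  rw [← h4]
  simp only [eval, h2, h3]

/-! ### Candidates -/

/-- All of `L[j..i]` is at least `l`. -/
def AllGe (j i l : ℕ) : Prop := ∀ t, j ≤ t → t ≤ i → l ≤ L t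

/-- The indices `j - 1` and `j` form a run boundary, and `k` is the one of them that carries the
character `c`. -/
def Cand {α : Type*} (b : ℕ → α) (c : α) (j k : ℕ) : Prop :=
  0 < j ∧ b j ≠ b (j - 1) ∧ (k = j ∨ k + 1 = j) ∧ b k = c

/-- No earlier candidate of the character `c` is connected to `j` at the level `L[j]`. -/
def IsFirst (c : Fin σ) (j : ℕ) : Prop :=
  ∀ j' k', j' < j → Cand b c j' k' → ¬ AllGe L j' j (L j)

/-- The candidate `(j, k)` of the character `c` is the pending choice after index `i`. -/
structure OpenSel (i : ℕ) (c : Fin σ) (j k : ℕ) : Prop where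
  cand : Cand b c j k
  le : j ≤ i
  first : IsFirst b L c j
  allGe : AllGe L j i (L j)
  max : ∀ j' k', j < j' → j' ≤ i → Cand b c j' k' → L j' ≤ L j

/-- The candidate `(j, k)` of the character `c` has been chosen for good up to index `i`. -/
def ClosedSel (i : ℕ) (c : Fin σ) (j k : ℕ) : Prop :=
  ∃ t, t < i ∧ OpenSel b L t c j k ∧ L (t + 1) < L j

variable {b L p}

theorem Cand.index_unique {α : Type*} {b : ℕ → α} {c : α} {j k k' : ℕ} (h : Cand b c j k)
    (h' : Cand b c j k') : k = k' := by
  obtain ⟨h0, h1, h2 | h2, h3⟩ := h <;> obtain ⟨-, -, h5 | h5, h6⟩ := h'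
  · omega
  · subst h2
    rw [show k - 1 = k' by omega] at h1
    exact absurd (h3.trans h6.symm) h1
  · subst h5
    rw [show k' - 1 = k by omega] at h1
    exact absurd (h6.trans h3.symm) h1
  · omega

theorem eagerStep_R_of_cand {i k : ℕ} {c : Fin σ} (st : OnePassState σ) (h : Cand b c i k) :
    (eagerStep b L p i st).R c =
      if (evalEntry (L i) (st.R c)).len < (L i : ℤ) then ⟨L i, p k, true⟩
      else evalEntry (L i) (st.R c) := by
  obtain ⟨h0, h1, h2, rfl⟩ := h
  rw [eagerStep, if_pos h1]
  simp only [activate_R, eval_R]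
  rcases h2 with rfl | h2
  · simp [h1]
  · obtain rfl : k = i - 1 := by omega
    have : b (i - 1) ≠ b i := fun h => h1 h.symm
    simp [this]

theorem eagerStep_R_of_not_cand {i : ℕ} {c : Fin σ} (st : OnePassState σ) (hi : 0 < i)
    (h : ∀ k, ¬ Cand b c i k) :
    (eagerStep b L p i st).R c = evalEntry (L i) (st.R c) := by
  rw [eagerStep]
  split_ifs with h1
  · have h2 : c ≠ b i := fun hc => h i ⟨hi, h1, Or.inl rfl, hc.symm⟩
    have h3 : c ≠ b (i - 1) := fun hc => h (i - 1) ⟨hi, h1, Or.inr (by omega), hc.symm⟩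
    simp [activate_R, h2, h3, eval_R]
  · rfl

theorem eagerStep_S (i : ℕ) (st : OnePassState σ) :
    (eagerStep b L p i st).S = (eval (L i) st).S := by
  rw [eagerStep]
  split_ifs <;> simp only [activate_S]

theorem AllGe.mono {j j' i i' l l' : ℕ} (h : AllGe L j i l) (hj : j ≤ j') (hi : i' ≤ i)
    (hl : l' ≤ l) : AllGe L j' i' l' :=
  fun t h1 h2 => hl.trans (h t (hj.trans h1) (h2.trans hi))

theorem AllGe.succ {j i l : ℕ} (h : AllGe L j i l) (hl : l ≤ L (i + 1)) : AllGe L j (i + 1) l := by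
  intro t h1 h2
  rcases Nat.lt_or_ge i t with h3 | h3
  · obtain rfl : t = i + 1 := by omega
    exact hl
  · exact h t h1 h3

theorem OpenSel.pred {i j k : ℕ} {c : Fin σ} (h : OpenSel b L (i + 1) c j k) (hj : j ≤ i) :
    OpenSel b L i c j k :=
  ⟨h.cand, hj, h.first, h.allGe.mono le_rfl (by omega) le_rfl,
    fun j' k' h1 h2 h3 => h.max j' k' h1 (by omega) h3⟩

variable (b L p) in
/-- What the table and the output of the algorithm hold after the iteration for the index `i`. -/
structure EagerInv (i : ℕ) (st : OnePassState σ) : Prop where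
  le_len_iff : ∀ c (l : ℕ), (l : ℤ) ≤ (st.R c).len ↔
    ∃ j k, Cand b c j k ∧ j ≤ i ∧ AllGe L j i l
  of_active : ∀ c, (st.R c).active = true →
    ∃ j k, OpenSel b L i c j k ∧ (st.R c).pos = p k ∧ (st.R c).len = L j
  of_openSel : ∀ c j k, OpenSel b L i c j k →
    (st.R c).active = true ∧ (st.R c).pos = p k ∧ (st.R c).len = L j
  mem_S : ∀ x, x ∈ st.S ↔ ∃ c j k, ClosedSel b L i c j k ∧ p k = x

theorem eagerInv_init : EagerInv b L p 0 (onePassInit σ) := by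
  refine ⟨?_, ?_, ?_, ?_⟩
  · intro c l
    simp only [onePassInit]
    constructor
    · intro h; omega
    · rintro ⟨j, k, ⟨h0, -⟩, h1, -⟩; omega
  · intro c h; simp [onePassInit] at h
  · rintro c j k ⟨⟨h0, -⟩, h1, -⟩; omega
  · intro x
    simp [onePassInit, ClosedSel]

theorem EagerInv.step {i : ℕ} {st : OnePassState σ} (h : EagerInv b L p i st) :
    EagerInv b L p (i + 1) (eagerStep b L p (i + 1) st) := by
  set l := L (i + 1) with hl
  have hlen : ∀ c, (evalEntry l (st.R c)).len = min (st.R c).len l := by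
    intro c
    unfold evalEntry
    split_ifs with h1
    · exact (min_eq_right h1.le).symm
    · exact (min_eq_left (not_lt.1 h1)).symm
  have hevle : ∀ c (x : ℕ), (x : ℤ) ≤ (evalEntry l (st.R c)).len ↔
      ∃ j k, Cand b c j k ∧ j ≤ i ∧ AllGe L j (i + 1) x := by
    intro c x
    rw [hlen, le_min_iff, h.le_len_iff]
    constructor
    · rintro ⟨⟨j, k, h1, h2, h3⟩, h4⟩
      exact ⟨j, k, h1, h2, h3.succ (by omega)⟩
    · rintro ⟨j, k, h1, h2, h3⟩
      refine ⟨⟨j, k, h1, h2, h3.mono le_rfl (by omega) le_rfl⟩, ?_⟩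
      have := h3 (i + 1) (by omega) le_rfl
      omega
  refine ⟨?_, ?_, ?_, ?_⟩
  · intro c x
    by_cases hc : ∃ k, Cand b c (i + 1) k
    · obtain ⟨k, hk⟩ := hc
      rw [eagerStep_R_of_cand st hk]
      have h1 : (∃ j k, Cand b c j k ∧ j ≤ i + 1 ∧ AllGe L j (i + 1) x) ↔
          (x : ℤ) ≤ (evalEntry l (st.R c)).len ∨ x ≤ l := by
        rw [hevle]
        constructor
        · rintro ⟨j, k, h1, h2, h3⟩
          exact Or.inr (h3 (i + 1) h2 le_rfl)
        · rintro (⟨j, k, h1, h2, h3⟩ | h1)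
          · exact ⟨j, k, h1, by omega, h3⟩
          · refine ⟨i + 1, k, hk, le_rfl, fun t h2 h3 => ?_⟩
            obtain rfl : t = i + 1 := by omega
            exact h1
      rw [h1, ← hl]
      have h2 := hlen c
      split_ifs with h3
      · simp only []; omega
      · omega
    · rw [eagerStep_R_of_not_cand st (by omega) (not_exists.1 hc), hevle]
      constructor
      · rintro ⟨j, k, h1, h2, h3⟩
        exact ⟨j, k, h1, by omega, h3⟩
      · rintro ⟨j, k, h1, h2, h3⟩
        refine ⟨j, k, h1, ?_, h3⟩
        rcases h2.eq_or_lt with rfl | h2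
        · exact absurd ⟨k, h1⟩ hc
        · omega
  · intro c
    have old : (evalEntry l (st.R c)).active = true →
        ((∃ k, Cand b c (i + 1) k) → (l : ℤ) ≤ (evalEntry l (st.R c)).len) →
        ∃ j k, OpenSel b L (i + 1) c j k ∧ (evalEntry l (st.R c)).pos = p k ∧
          (evalEntry l (st.R c)).len = L j := by
      unfold evalEntry
      split_ifs with h1
      · simp
      · intro h2 h3
        obtain ⟨j, k, h4, h5, h6⟩ := h.of_active c h2
        refine ⟨j, k, ⟨h4.cand, h4.le.trans (by omega), h4.first, h4.allGe.succ (by omega), ?_⟩,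
          h5, h6⟩
        intro j' k' h7 h8 h9
        rcases h8.eq_or_lt with rfl | h8
        · have := h3 ⟨k', h9⟩
          omega
        · exact h4.max j' k' h7 (by omega) h9
    by_cases hc : ∃ k, Cand b c (i + 1) k
    · obtain ⟨k, hk⟩ := hc
      rw [eagerStep_R_of_cand st hk]
      split_ifs with h1
      · intro _
        refine ⟨i + 1, k, ⟨hk, le_rfl, ?_, ?_, ?_⟩, rfl, rfl⟩
        · intro j' k' h2 h3 h4
          exact absurd ((hevle c l).2 ⟨j', k', h3, by omega, h4⟩) (not_le.2 h1)
        · intro t h2 h3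
          obtain rfl : t = i + 1 := by omega
          exact le_rfl
        · intro j' k' h2 h3; omega
      · exact fun h2 => old h2 (fun _ => not_lt.1 h1)
    · rw [eagerStep_R_of_not_cand st (by omega) (not_exists.1 hc)]
      exact fun h2 => old h2 (fun h3 => absurd h3 hc)
  · intro c j k hs
    rcases hs.le.eq_or_lt with rfl | hj
    · rw [eagerStep_R_of_cand st hs.cand, if_pos]
      · exact ⟨rfl, rfl, rfl⟩
      · by_contra h1
        obtain ⟨j', k', h2, h3, h4⟩ := (hevle c l).1 (not_lt.1 h1)
        exact hs.first j' k' (by omega) h2 h4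
    · have h1 := h.of_openSel c j k (hs.pred (by omega))
      have h2 : L j ≤ l := hs.allGe (i + 1) (by omega) le_rfl
      have h3 : evalEntry l (st.R c) = st.R c := by
        unfold evalEntry
        rw [if_neg]
        omega
      by_cases hc : ∃ k, Cand b c (i + 1) k
      · obtain ⟨k', hk'⟩ := hc
        have h4 := hs.max _ _ hj le_rfl hk'
        rw [eagerStep_R_of_cand st hk', h3, if_neg]
        · exact h1
        · omega
      · rw [eagerStep_R_of_not_cand st (by omega) (not_exists.1 hc), h3]
        exact h1
  · intro x
    rw [eagerStep_S, mem_eval_S, h.mem_S]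
    constructor
    · rintro (⟨c, j, k, ⟨t, h1, h2, h3⟩, h4⟩ | ⟨c, h1, h2, h3⟩)
      · exact ⟨c, j, k, ⟨t, by omega, h2, h3⟩, h4⟩
      · obtain ⟨j, k, h4, h5, h6⟩ := h.of_active c h2
        exact ⟨c, j, k, ⟨i, by omega, h4, by omega⟩, h5.symm.trans h3⟩
    · rintro ⟨c, j, k, ⟨t, h1, h2, h3⟩, h4⟩
      rcases (Nat.lt_succ_iff.1 h1).eq_or_lt with rfl | h1
      · obtain ⟨h5, h6, h7⟩ := h.of_openSel c j k h2
        exact Or.inr ⟨c, by omega, h5, h6.trans h4⟩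
      · exact Or.inl ⟨c, j, k, ⟨t, h1, h2, h3⟩, h4⟩

theorem eagerInv (i : ℕ) : EagerInv b L p i (eagerState b L p i) := by
  induction i with
  | zero => exact eagerInv_init
  | succ i ih => exact ih.step

/-- The position of a candidate that is about to be activated was not chosen before. -/
theorem EagerInv.notMem_S {i n : ℕ} {st : OnePassState σ} (h : EagerInv b L p i st)
    (hi : i + 1 < n) (hp : ∀ k < n, ∀ k' < n, p k = p k' → k = k') {c : Fin σ} {k : ℕ}
    (hc : Cand b c (i + 1) k)
    (hlen : (evalEntry (L (i + 1)) (st.R c)).len < (L (i + 1) : ℤ)) :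
    p k ∉ (eval (L (i + 1)) st).S := by
  intro hx
  rw [← eagerStep_S (b := b) (p := p)] at hx
  obtain ⟨c', j', k', ⟨t, h1, h2, h3⟩, h4⟩ := (h.step.mem_S _).1 hx
  have h5 := h2.cand.2.2.1
  have h6 := h2.le
  have h7 := hc.2.2.1
  obtain rfl : k' = k := hp k' (by omega) k (by omega) h4
  obtain rfl : c' = c := h2.cand.2.2.2.symm.trans hc.2.2.2
  have h8 : j' = t := by omega
  have h9 : t = i := by omega
  subst h8 h9
  have h10 := (h.le_len_iff c' (L (j' + 1))).2 ⟨j', k', h2.cand, le_rfl, fun x hx1 hx2 => by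
    obtain rfl : x = j' := by omega
    exact h3.le⟩
  unfold evalEntry at hlen
  split_ifs at hlen
  · exact lt_irrefl _ hlen
  · omega

end Eager

/-! ### The chosen candidates -/

section Selected

variable {σ : ℕ} {b : ℕ → Fin σ} {L p : ℕ → ℕ}

variable (b L) in
/-- The candidate `(j, k)` of the character `c` is the first one of largest level among those
connected to it. -/
structure Selected (n : ℕ) (c : Fin σ) (j k : ℕ) : Prop where
  cand : Cand b c j k
  lt : j < n
  first : IsFirst b L c j
  max : ∀ j' k', j < j' → j' < n → Cand b c j' k' → AllGe L j j' (L j) → L j' ≤ L j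

theorem mem_eval_eagerState_iff {n : ℕ} (hn : 0 < n) (x : ℕ) :
    x ∈ (eval (-1) (eagerState b L p (n - 1))).S ↔ ∃ c j k, Selected b L n c j k ∧ p k = x := by
  have hI := eagerInv (b := b) (L := L) (p := p) (n - 1)
  rw [mem_eval_S, hI.mem_S]
  constructor
  · rintro (⟨c, j, k, ⟨t, h1, h2, h3⟩, h4⟩ | ⟨c, h1, h2, h3⟩)
    · have h5 := h2.le
      refine ⟨c, j, k, ⟨h2.cand, by omega, h2.first, ?_⟩, h4⟩
      intro j' k' h6 h7 h8 h9
      rcases Nat.lt_or_ge t j' with h10 | h10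
      · have := h9 (t + 1) (by omega) h10
        omega
      · exact h2.max j' k' h6 h10 h8
    · obtain ⟨j, k, h4, h5, h6⟩ := hI.of_active c h2
      have h7 := h4.le
      exact ⟨c, j, k, ⟨h4.cand, by omega, h4.first,
        fun j' k' h8 h9 h10 _ => h4.max j' k' h8 (by omega) h10⟩, h5.symm.trans h3⟩
  · rintro ⟨c, j, k, h, rfl⟩
    have h0 := h.lt
    by_cases hall : AllGe L j (n - 1) (L j)
    · obtain ⟨h1, h2, h3⟩ := hI.of_openSel c j k ⟨h.cand, by omega, h.first, hall,
        fun j' k' h1 h2 h3 => h.max j' k' h1 (by omega) h3 (hall.mono le_rfl h2 le_rfl)⟩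
      exact Or.inr ⟨c, by omega, h1, h2⟩
    · have hex : ∃ t, j ≤ t ∧ t ≤ n - 1 ∧ L t < L j := by
        unfold AllGe at hall
        push Not at hall
        exact hall
      classical
      obtain ⟨h1, h2, h3⟩ := Nat.find_spec hex
      have hmin := fun t (ht : t < Nat.find hex) => Nat.find_min hex ht
      generalize Nat.find hex = t at h1 h2 h3 hmin
      have h4 : j ≠ t := by rintro rfl; omega
      have hall' : AllGe L j (t - 1) (L j) := by
        intro t' h5 h6
        by_contra h7
        exact hmin t' (by omega) ⟨h5, by omega, by omega⟩
      refine Or.inl ⟨c, j, k, ⟨t - 1, by omega, ⟨h.cand, by omega, h.first, hall', ?_⟩, ?_⟩, rfl⟩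
      · intro j' k' h5 h6 h7
        exact h.max j' k' h5 (by omega) h7 (hall'.mono le_rfl h6 le_rfl)
      · rwa [Nat.sub_add_cancel (by omega)]

theorem Cand.exists_selected {n j k : ℕ} {c : Fin σ} (h : Cand b c j k) (hj : j < n) :
    ∃ j' k', Selected b L n c j' k' ∧ AllGe L (min j j') (max j j') (L j) := by
  classical
  let B := (Finset.range n).filter
    (fun j' => (∃ k', Cand b c j' k') ∧ AllGe L (min j j') (max j j') (L j))
  have hB : ∀ j', j' ∈ B ↔ j' < n ∧ (∃ k', Cand b c j' k') ∧
      AllGe L (min j j') (max j j') (L j) := by simp [B]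
  have hjB : j ∈ B := by
    refine (hB j).2 ⟨hj, ⟨k, h⟩, fun t h1 h2 => ?_⟩
    obtain rfl : t = j := by omega
    exact le_rfl
  obtain ⟨j₁, hj₁, hmax⟩ := B.exists_max_image L ⟨j, hjB⟩
  obtain ⟨j₂, hj₂, hmin⟩ := (B.filter (fun x => L x = L j₁)).exists_min_image id
    ⟨j₁, by simp [hj₁]⟩
  rw [Finset.mem_filter] at hj₂
  obtain ⟨hj₂, hL⟩ := hj₂
  obtain ⟨h1, ⟨k', h2⟩, h3⟩ := (hB j₂).1 hj₂
  have hjL : L j ≤ L j₂ := hL ▸ hmax j hjB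
  refine ⟨j₂, k', ⟨h2, h1, ?_, ?_⟩, h3⟩
  · intro j' k'' h4 h5 h6
    have h7 : j' ∈ B := by
      refine (hB j').2 ⟨by omega, ⟨k'', h5⟩, fun t h8 h9 => ?_⟩
      by_cases h10 : min j j₂ ≤ t ∧ t ≤ max j j₂
      · exact h3 t h10.1 h10.2
      · exact hjL.trans (h6 t (by omega) (by omega))
    have h8 : L j₂ ≤ L j' := h6 j' le_rfl h4.le
    have h9 := hmin j' (Finset.mem_filter.2 ⟨h7, le_antisymm (hmax _ h7) (hL ▸ h8)⟩)
    simp only [id] at h9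
    omega
  · intro j' k'' h4 h5 h6 h7
    rw [hL]
    refine hmax j' ((hB j').2 ⟨h5, ⟨k'', h6⟩, fun t h8 h9 => ?_⟩)
    by_cases h10 : min j j₂ ≤ t ∧ t ≤ max j j₂
    · exact h3 t h10.1 h10.2
    · exact hjL.trans (h7 t (by omega) (by omega))

/-- The suffixes of indices `k` and `k'` agree on their first `l` characters. -/
def Conn (L : ℕ → ℕ) (l k k' : ℕ) : Prop :=
  ∀ t, min k k' < t → t ≤ max k k' → l ≤ L t

theorem Selected.not_conn {n j k j' k' : ℕ} {c : Fin σ} (h : Selected b L n c j k)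
    (h' : Selected b L n c j' k') (hne : k ≠ k') : ¬ Conn L (min (L j) (L j')) k k' := by
  wlog hlt : j < j' generalizing j k j' k'
  · rcases (not_lt.1 hlt).eq_or_lt with rfl | hlt'
    · exact absurd (h.cand.index_unique h'.cand) hne
    · intro hc
      refine this h' h hne.symm hlt' ?_
      rw [min_comm]
      intro t h1 h2
      exact hc t (by omega) (by omega)
  intro hc
  have h1 := h.cand.2.2.1
  have h2 := h'.cand.2.2.1
  have hall : AllGe L j j' (min (L j) (L j')) := by
    intro t h3 h4
    rcases h3.eq_or_lt with rfl | h3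
    · exact min_le_left _ _
    · rcases h4.eq_or_lt with rfl | h4
      · exact min_le_right _ _
      · exact hc t (by omega) (by omega)
  rcases le_or_gt (L j) (L j') with h3 | h3
  · rw [min_eq_left h3] at hall
    have h4 := h.max j' k' hlt h'.lt h'.cand hall
    exact h'.first j k hlt h.cand (le_antisymm h4 h3 ▸ hall)
  · rw [min_eq_right h3.le] at hall
    exact h'.first j k hlt h.cand hall

theorem exists_change_right {k k' : ℕ} (h : k < k') {c : Fin σ} (hk : b k = c) (hk' : b k' ≠ c) :
    ∃ j, k < j ∧ j ≤ k' ∧ b (j - 1) = c ∧ b j ≠ c := by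
  induction k', h using Nat.le_induction with
  | base => exact ⟨k + 1, by omega, le_rfl, by simpa using hk, hk'⟩
  | succ m hm ih =>
    by_cases hc : b m = c
    · exact ⟨m + 1, by omega, le_rfl, by simpa using hc, hk'⟩
    · obtain ⟨j, h1, h2, h3⟩ := ih hc
      exact ⟨j, h1, by omega, h3⟩

theorem exists_change_left {k k' : ℕ} (h : k' < k) {c : Fin σ} (hk : b k = c) (hk' : b k' ≠ c) :
    ∃ j, k' < j ∧ j ≤ k ∧ b (j - 1) ≠ c ∧ b j = c := by
  induction k, h using Nat.le_induction with
  | base => exact ⟨k' + 1, by omega, le_rfl, by simpa using hk', hk⟩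
  | succ m hm ih =>
    by_cases hc : b m = c
    · obtain ⟨j, h1, h2, h3⟩ := ih hc
      exact ⟨j, h1, by omega, h3⟩
    · exact ⟨m + 1, by omega, le_rfl, by simpa using hc, hk⟩

theorem Conn.exists_cand {n l k k' : ℕ} (h : Conn L l k k') (hk : k < n) (hk' : k' < n)
    (hb : b k' ≠ b k) : ∃ j i, Cand b (b k) j i ∧ j < n ∧ l ≤ L j ∧ Conn L l k i := by
  have hne : k ≠ k' := by rintro rfl; exact hb rfl
  rcases hne.lt_or_gt with hlt | hlt
  · obtain ⟨j, h1, h2, h3, h4⟩ := exists_change_right hlt rfl hb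
    exact ⟨j, j - 1, ⟨by omega, fun h5 => h4 (h5.trans h3), Or.inr (by omega), h3⟩, by omega,
      h j (by omega) (by omega), fun t h5 h6 => h t (by omega) (by omega)⟩
  · obtain ⟨j, h1, h2, h3, h4⟩ := exists_change_left hlt rfl hb
    exact ⟨j, j, ⟨by omega, fun h5 => h3 (h5.symm.trans h4), Or.inl rfl, h4⟩, by omega,
      h j (by omega) (by omega), fun t h5 h6 => h t (by omega) (by omega)⟩

theorem Conn.trans {l k k' k'' : ℕ} (h : Conn L l k k') (h' : Conn L l k' k'') :
    Conn L l k k'' := by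
  intro t h1 h2
  by_cases h3 : min k k' < t ∧ t ≤ max k k'
  · exact h t h3.1 h3.2
  · exact h' t (by omega) (by omega)

theorem IsArrays.conn_iff {T : List (Fin σ)} {s : ℕ → ℕ} (h : IsArrays T b L s) {k k' : ℕ}
    (hk : k < T.length) (hk' : k' < T.length) (hne : k ≠ k') (l : ℕ) :
    Conn L l k k' ↔ SufEq T l (T.length - s k) (T.length - s k') := by
  rcases hne.lt_or_gt with hlt | hlt
  · rw [← h.lcp_iff k k' hlt hk', Conn, min_eq_left hlt.le, max_eq_right hlt.le]
  · rw [Conn, min_eq_right hlt.le, max_eq_left hlt.le, h.lcp_iff k' k hlt hk]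
    exact ⟨SufEq.symm, SufEq.symm⟩

end Selected

/-! ### The chosen positions form a smallest suffixient set -/

section Smallest

variable {α : Type*}

theorem take_succ_of_getElem? {T : List α} {y : ℕ} {c : α} (h : T[y]? = some c) :
    T.take (y + 1) = T.take y ++ [c] := by
  rw [List.take_add_one, h]; rfl

theorem SufEq.isSuffix {T : List α} {l y y' : ℕ} {c : α} (h : SufEq T l y y')
    (hy : T[y]? = some c) (hy' : T[y']? = some c) :
    (T.take (y + 1)).drop (y - l) <:+ T.take (y' + 1) := by
  have h1 := (List.getElem?_eq_some_iff.1 hy).1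
  rw [take_succ_of_getElem? hy, take_succ_of_getElem? hy',
    List.drop_append_of_le_length (by simp; omega), h.2.2]
  exact ⟨(T.take y').take (y' - l), by rw [← List.append_assoc, List.take_append_drop]⟩

theorem sufEq_of_isSuffix {T : List α} {l y z : ℕ} {c : α} (hl : l ≤ y) (hy : T[y]? = some c)
    (hz : z < T.length) (h : (T.take (y + 1)).drop (y - l) <:+ T.take (z + 1)) :
    SufEq T l y z ∧ T[z]? = some c := by
  have h1 := (List.getElem?_eq_some_iff.1 hy).1
  have hz' : T[z]? = some T[z] := List.getElem?_eq_getElem hz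
  obtain ⟨pre, hpre⟩ := h
  rw [take_succ_of_getElem? hy, take_succ_of_getElem? hz',
    List.drop_append_of_le_length (by simp; omega), ← List.append_assoc] at hpre
  obtain ⟨h2, h3⟩ := List.append_inj' hpre rfl
  have h4 : T[z] = c := by simpa using h3.symm
  have h5 := congrArg List.length h2
  simp only [List.length_append, List.length_drop, List.length_take, min_eq_left h1.le,
    min_eq_left hz.le] at h5
  refine ⟨⟨hl, by omega, ?_⟩, by rw [hz', h4]⟩
  rw [← h2, List.drop_append_of_le_length (by omega), List.drop_of_length_le (l := pre) (by omega)]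
  rfl

theorem getElem?_of_isInfix {T β : List α} {a : α} (h : (β ++ [a]) <:+: T) :
    ∃ y, T[y]? = some a ∧ β.length ≤ y ∧ (T.take y).drop (y - β.length) = β := by
  obtain ⟨pre, post, rfl⟩ := h
  refine ⟨pre.length + β.length, ?_, by omega, ?_⟩
  · rw [List.append_assoc, List.getElem?_append_right (by omega), List.append_assoc,
      List.getElem?_append_right (by omega)]
    simp
  · rw [show pre ++ (β ++ [a]) ++ post = (pre ++ β) ++ ([a] ++ post) by simp,
      List.take_append_of_le_length (by simp), List.take_of_length_le (by simp)]
    simp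

theorem isInfix_of_getElem? {T : List α} {y l : ℕ} {c : α} (h : T[y]? = some c) (hl : l ≤ y) :
    ((T.take y).drop (y - l) ++ [c]) <:+: T := by
  have h1 := (SufEq.refl (T := T) hl).isSuffix h h
  have h2 := (List.getElem?_eq_some_iff.1 h).1
  rw [take_succ_of_getElem? h, List.drop_append_of_le_length (by simp; omega),
    ← take_succ_of_getElem? h] at h1
  exact h1.isInfix.trans (List.take_prefix _ _).isInfix

theorem exists_getElem?_ne_of_rightMaximal {σ : ℕ} {T : List (Fin σ)} (hT : IsText T) {l y : ℕ}
    {c : Fin σ} (hl : l ≤ y) (hy : T[y]? = some c)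
    (h : RightMaximal T ((T.take y).drop (y - l))) :
    ∃ y' c', T[y']? = some c' ∧ c' ≠ c ∧ SufEq T l y y' := by
  have hylt := (List.getElem?_eq_some_iff.1 hy).1
  have hlen : ((T.take y).drop (y - l)).length = l := by simp; omega
  rcases h with h | ⟨a, a', hne, ha, ha'⟩
  · obtain ⟨h2, u, d, rfl, -, hd⟩ := hT
    simp only [List.length_append, List.length_singleton] at h2 hylt
    rw [List.take_append_of_le_length (by omega)] at h hlen
    have hl0 : l = 0 := by
      by_contra hl0
      have h3 : (u.take y).drop (y - l) ≠ [] := by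
        intro h; rw [h] at hlen; simp at hlen; omega
      obtain ⟨pre, hpre⟩ := h
      rw [← List.dropLast_append_getLast h3, ← List.append_assoc] at hpre
      have h4 := (List.append_inj' hpre rfl).2
      simp only [List.cons.injEq, and_true] at h4
      have h5 := List.mem_of_mem_take (List.mem_of_mem_drop (List.getLast_mem h3))
      rw [h4] at h5
      exact hd h5
    subst hl0
    have hS : ∀ y', SufEq (u ++ [d]) 0 y y' := fun y' => ⟨by omega, by omega, by simp⟩
    by_cases hc : c = d
    · refine ⟨0, u[0], ?_, ?_, hS _⟩
      · rw [List.getElem?_append_left (by omega)]; simp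
      · rw [hc]; intro h; exact hd (h ▸ List.getElem_mem _)
    · exact ⟨u.length, d, by simp, fun h => hc h.symm, hS _⟩
  · have key : ∀ e, e ≠ c → ((T.take y).drop (y - l) ++ [e]) <:+: T →
        ∃ y' c', T[y']? = some c' ∧ c' ≠ c ∧ SufEq T l y y' := by
      intro e he h1
      obtain ⟨y', h2, h3, h4⟩ := getElem?_of_isInfix h1
      rw [hlen] at h3 h4
      exact ⟨y', e, h2, he, hl, h3, h4.symm⟩
    by_cases hc : a = c
    · exact key a' (fun h => hne (hc.trans h.symm)) ha'
    · exact key a hc ha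

theorem IsArrays.exists_index {T : List α} {b : ℕ → α} {L s : ℕ → ℕ} (h : IsArrays T b L s) {y : ℕ}
    (hy : y < T.length) : ∃ k < T.length, T.length - s k = y ∧ T[y]? = some (b k) := by
  obtain ⟨k, hk, hs⟩ := h.surj (T.length - y) (by omega) (by omega)
  have h1 : T.length - s k = y := by omega
  exact ⟨k, hk, h1, h1 ▸ h.getElem? k hk⟩

variable {σ : ℕ} {T : List (Fin σ)} {b : ℕ → Fin σ} {L s : ℕ → ℕ}

theorem isSuffixient_selected (hT : IsText T) (h : IsArrays T b L s) {S : Finset ℕ}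
    (hS : ∀ x, x ∈ S ↔ ∃ c j k, Selected b L T.length c j k ∧ T.length - s k + 1 = x) :
    IsSuffixient T S := by
  constructor
  · intro x hx
    obtain ⟨c, j, k, h1, rfl⟩ := (hS x).1 hx
    have h2 := h1.cand.2.2.1
    have h3 := h1.lt
    have h4 := h.one_le k (by omega)
    have := h.le_length k (by omega)
    rw [Finset.mem_Icc]
    omega
  · intro i j hi hij hj hrm
    obtain ⟨y, rfl⟩ : ∃ y, j = y + 1 := ⟨j - 1, by omega⟩
    obtain ⟨l, hl, rfl⟩ : ∃ l, l ≤ y ∧ i = y - l + 1 := ⟨y + 1 - i, by omega, by omega⟩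
    simp only [Nat.add_sub_cancel] at hrm ⊢
    obtain ⟨k, hk, hky, hkb⟩ := h.exists_index (y := y) (by omega)
    obtain ⟨y', c', h1, h2, h3⟩ := exists_getElem?_ne_of_rightMaximal hT hl hkb hrm
    obtain ⟨k₁, hk₁, hky₁, hkb₁⟩ := h.exists_index (List.getElem?_eq_some_iff.1 h1).1
    have h4 : b k₁ ≠ b k := by
      rw [hkb₁] at h1
      rw [Option.some.inj h1]
      exact h2
    have hne : k ≠ k₁ := by rintro rfl; exact h4 rfl
    rw [← hky, ← hky₁, ← h.conn_iff hk hk₁ hne] at h3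
    obtain ⟨j, k₂, h5, h6, h7, h8⟩ := h3.exists_cand hk hk₁ h4
    obtain ⟨j', k₃, h9, h10⟩ := h5.exists_selected (L := L) h6
    have h11 := h5.2.2.1
    have h12 := h9.cand.2.2.1
    have h13 := h9.lt
    have h14 : Conn L l k k₃ := h8.trans fun t h15 h16 =>
      h7.trans (h10 t (by omega) (by omega))
    refine ⟨_, (hS _).2 ⟨_, _, _, h9, rfl⟩, ?_⟩
    have hk₃ : k₃ < T.length := by omega
    have h15 : SufEq T l y (T.length - s k₃) := by
      by_cases hkk : k = k₃
      · subst hkk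
        rw [hky]
        exact SufEq.refl hl
      · rw [← hky, ← h.conn_iff hk hk₃ hkk]
        exact h14
    exact h15.isSuffix hkb (h9.cand.2.2.2 ▸ h.getElem? k₃ hk₃)

theorem card_selected_le (h : IsArrays T b L s) {S S' : Finset ℕ}
    (hS : ∀ x, x ∈ S ↔ ∃ c j k, Selected b L T.length c j k ∧ T.length - s k + 1 = x)
    (hS' : IsSuffixient T S') : S.card ≤ S'.card := by
  have key : ∀ x ∈ S, ∃ z j k, Selected b L T.length (b k) j k ∧ T.length - s k + 1 = x ∧
      z + 1 ∈ S' ∧ T[z]? = some (b k) ∧ SufEq T (L j) (T.length - s k) z := by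
    intro x hx
    obtain ⟨c, j, k, h1, h2⟩ := (hS x).1 hx
    have hj := h1.lt
    obtain ⟨h3, h4, h5, h6⟩ := h1.cand
    have hk : k < T.length := by omega
    obtain ⟨k', hk', hne, hb, hconn⟩ : ∃ k' < T.length, k ≠ k' ∧ b k' ≠ b k ∧
        Conn L (L j) k k' := by
      rcases h5 with rfl | h5
      · refine ⟨k - 1, by omega, by omega, h4.symm, fun t h7 h8 => ?_⟩
        obtain rfl : t = k := by omega
        exact le_rfl
      · obtain rfl : k = j - 1 := by omega
        refine ⟨j, hj, by omega, h4, fun t h7 h8 => ?_⟩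
        obtain rfl : t = j := by omega
        exact le_rfl
    have hse := (h.conn_iff hk hk' hne _).1 hconn
    have h7 := h.one_le k hk
    have h8 := h.getElem? k hk
    rw [h6] at h8 hb
    have h9 := h.getElem? k' hk'
    set y := T.length - s k with hy
    obtain ⟨z, h10, h11⟩ := hS'.2 (y - L j + 1) (y + 1) (by omega) (by omega) (by omega) (by
      simp only [Nat.add_sub_cancel]
      refine Or.inr ⟨c, b k', hb.symm, isInfix_of_getElem? h8 hse.1, ?_⟩
      rw [hse.2.2]
      exact isInfix_of_getElem? h9 hse.2.1)
    have h12 := Finset.mem_Icc.1 (hS'.1 h10)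
    obtain ⟨z, rfl⟩ : ∃ z', z = z' + 1 := ⟨z - 1, by omega⟩
    simp only [Nat.add_sub_cancel] at h11
    obtain ⟨h13, h14⟩ := sufEq_of_isSuffix hse.1 h8 (by omega) h11
    exact ⟨z, j, k, h6.symm ▸ h1, h2, h10, h6.symm ▸ h14, h13⟩
  choose! f j k h1 h2 h3 h4 h5 using key
  refine Finset.card_le_card_of_injOn (fun x => f x + 1) (fun x hx => h3 x hx) ?_
  intro x hx x' hx' hf
  simp only [Nat.add_right_cancel_iff] at hf
  rw [Finset.mem_coe] at hx hx'
  have hc : b (k x) = b (k x') := by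
    have := h4 x hx
    rw [hf, h4 x' hx'] at this
    exact (Option.some.inj this).symm
  by_contra hne
  have hkk : k x ≠ k x' := by
    intro hkk
    apply hne
    rw [← h2 x hx, ← h2 x' hx', hkk]
  have hs' := h1 x' hx'
  rw [← hc] at hs'
  refine (h1 x hx).not_conn hs' hkk ?_
  have ha := (h1 x hx).cand.2.2.1
  have ha' := (h1 x hx).lt
  have hb := hs'.cand.2.2.1
  have hb' := hs'.lt
  rw [h.conn_iff (by omega) (by omega) hkk]
  have h6 := (h5 x hx).mono (min_le_left _ (L (j x')))
  have h7 := (h5 x' hx').mono (min_le_right (L (j x)) _)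
  rw [hf] at h6
  exact h6.trans h7.symm

theorem isSmallestSuffixient_onePass (hT : IsText T) (h : IsArrays T b L s)
    (ha : arrays T = (List.range T.length).map (fun k => (b k, L k, s k))) :
    IsSmallestSuffixient T (onePass T) := by
  have hn : 0 < T.length := by
    have := hT.1
    omega
  have hS : ∀ x, x ∈ onePass T ↔
      ∃ c j k, Selected b L T.length c j k ∧ T.length - s k + 1 = x := by
    intro x
    rw [onePass_eq_eager b L ha, mem_eval_eagerState_iff hn]
  exact ⟨isSuffixient_selected hT h hS, fun S' hS' => card_selected_le h hS hS'⟩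

end Smallest

/-! ### Lazy evaluation

Instead of performing `eval(l)` on all entries of the table at once, the program keeps, for each
character `c`, the number `e c = n - l` for the smallest `l` that is still to be applied to the
entry of `c`, where `e c = 0` stands for `l = ∞`. The stored entry consists of `len + 1` and of the
position, which is `0` if the entry is not active. -/

section Lazy

variable {σ : ℕ}

/-- The table and the output `out` of the lazy algorithm represent the state `st`. -/
structure LazyRel (n : ℕ) (st : OnePassState σ) (len pos e : ℕ → ℕ) (out : List ℕ) : Prop where
  e_le : ∀ c : Fin σ, e c ≤ n
  len_le : ∀ c : Fin σ, len c ≤ n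
  entry_pending : ∀ c : Fin σ, n + 1 < len c + e c → st.R c = ⟨(n : ℤ) - e c, 0, false⟩
  entry : ∀ c : Fin σ, len c + e c ≤ n + 1 →
    st.R c = ⟨(len c : ℤ) - 1, pos c, decide (0 < pos c)⟩
  mem_S : ∀ x, x ∈ st.S ↔
    x ∈ out ∨ ∃ c : Fin σ, n + 1 < len c + e c ∧ 0 < pos c ∧ pos c = x
  nodup : out.Nodup
  notMem_out : ∀ c : Fin σ, 0 < pos c → pos c ∉ out
  pos_inj : ∀ c c' : Fin σ, 0 < pos c → pos c = pos c' → c = c'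
  len_pos : ∀ c : Fin σ, 0 < pos c → 0 < len c

variable {n : ℕ} {st : OnePassState σ} {len pos e : ℕ → ℕ} {out : List ℕ}

theorem lazyRel_init (n : ℕ) :
    LazyRel n (onePassInit σ) (fun _ => 0) (fun _ => 0) (fun _ => 0) [] := by
  refine ⟨?_, ?_, ?_, ?_, ?_, ?_, ?_, ?_, ?_⟩ <;> simp [onePassInit]

theorem LazyRel.congr {len' pos' e' : ℕ → ℕ} (h : LazyRel n st len pos e out)
    (h1 : ∀ c : Fin σ, len' c = len c) (h2 : ∀ c : Fin σ, pos' c = pos c)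
    (h3 : ∀ c : Fin σ, e' c = e c) : LazyRel n st len' pos' e' out := by
  obtain ⟨a1, a2, a3, a4, a5, a6, a7, a8, a9⟩ := h
  constructor <;> simpa only [h1, h2, h3]

theorem LazyRel.eval {l : ℕ} (h : LazyRel n st len pos e out) (hl : l ≤ n) :
    LazyRel n (eval l st) len pos (fun c => max (e c) (n - l)) out := by
  refine ⟨?_, h.len_le, ?_, ?_, ?_, h.nodup, h.notMem_out, h.pos_inj,
    h.len_pos⟩
  · intro c
    have := h.e_le c
    omega
  · intro c hc
    rw [eval_R, evalEntry]
    by_cases h1 : n + 1 < len c + e c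
    · rw [h.entry_pending c h1]
      have := h.e_le c
      split_ifs with h2
      · simp only [] at h2
        congr 1; omega
      · simp only [not_lt] at h2
        congr 1; omega
    · rw [h.entry c (by omega), if_pos (by simp only []; omega)]
      congr 1; omega
  · intro c hc
    rw [eval_R, evalEntry, h.entry c (by omega), if_neg (by simp only []; omega)]
  · intro x
    rw [mem_eval_S, h.mem_S]
    constructor
    · rintro ((h1 | ⟨c, h1, h2, h3⟩) | ⟨c, h1, h2, h3⟩)
      · exact Or.inl h1
      · exact Or.inr ⟨c, by omega, h2, h3⟩
      · by_cases h4 : n + 1 < len c + e c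
        · rw [h.entry_pending c h4] at h2
          exact absurd h2 (by simp)
        · rw [h.entry c (by omega)] at h1 h2 h3
          simp only [decide_eq_true_eq] at h1 h2 h3
          exact Or.inr ⟨c, by omega, h2, h3⟩
    · rintro (h1 | ⟨c, h1, h2, h3⟩)
      · exact Or.inl (Or.inl h1)
      · by_cases h4 : n + 1 < len c + e c
        · exact Or.inl (Or.inr ⟨c, h4, h2, h3⟩)
        · refine Or.inr ⟨c, ?_⟩
          rw [h.entry c (by omega)]
          refine ⟨?_, by simpa using h2, h3⟩
          simp only []
          omega

theorem LazyRel.flush_of_le {c : Fin σ} (h : LazyRel n st len pos e out)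
    (hc : len c + e c ≤ n + 1) :
    LazyRel n st len pos (Function.update e c 0) out := by
  have key : ∀ c' : Fin σ, n + 1 < len c' + Function.update e c 0 c' ↔ n + 1 < len c' + e c' := by
    intro c'
    by_cases hcc : c' = c
    · subst hcc
      have := h.len_le c'
      simp only [Function.update_self]
      omega
    · rw [Function.update_of_ne (fun h => hcc (Fin.ext h))]
  have key' : ∀ c' : Fin σ, n + 1 < len c' + e c' → Function.update e c 0 (c' : ℕ) = e c' := by
    intro c' h1
    rw [Function.update_of_ne]
    intro h2
    rw [h2] at h1
    omega
  refine ⟨?_, h.len_le, ?_, ?_, ?_, h.nodup, h.notMem_out, h.pos_inj,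
    h.len_pos⟩
  · intro c'
    have := h.e_le c'
    rw [Function.update_apply]
    split_ifs <;> omega
  · intro c' h1
    rw [key] at h1
    rw [key' c' h1]
    exact h.entry_pending c' h1
  · intro c' h1
    exact h.entry c' (not_lt.1 fun h2 => (not_lt.2 h1) ((key c').2 h2))
  · intro x
    simp only [key]
    exact h.mem_S x

theorem LazyRel.flush_of_lt {c : Fin σ} (h : LazyRel n st len pos e out)
    (hc : n + 1 < len c + e c) :
    LazyRel n st (Function.update len c (n + 1 - e c)) (Function.update pos c 0)
      (Function.update e c 0) (if 0 < pos c then out ++ [pos c] else out) := by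
  have hmem : ∀ x, x ∈ (if 0 < pos c then out ++ [pos c] else out) ↔
      x ∈ out ∨ (0 < pos c ∧ pos c = x) := by
    intro x
    split_ifs with h1
    · simp [h1, eq_comm]
    · simp [h1]
  have hne : ∀ c' : Fin σ, c' ≠ c → (c' : ℕ) ≠ c := fun c' h1 h2 => h1 (Fin.ext h2)
  refine ⟨?_, ?_, ?_, ?_, ?_, ?_, ?_, ?_, ?_⟩
  · intro c'
    have := h.e_le c'
    rw [Function.update_apply]
    split_ifs <;> omega
  · intro c'
    have := h.len_le c'
    have := h.len_le c
    rw [Function.update_apply]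
    split_ifs <;> omega
  · intro c' h1
    by_cases hcc : c' = c
    · subst hcc
      simp only [Function.update_self] at h1
      omega
    · simp only [Function.update_of_ne (hne c' hcc)] at h1 ⊢
      exact h.entry_pending c' h1
  · intro c' h1
    by_cases hcc : c' = c
    · subst hcc
      have := h.e_le c'
      simp only [Function.update_self]
      rw [h.entry_pending c' hc]
      congr 1
      omega
    · simp only [Function.update_of_ne (hne c' hcc)] at h1 ⊢
      exact h.entry c' h1
  · intro x
    rw [h.mem_S, hmem, or_assoc]
    refine or_congr_right ?_
    constructor
    · rintro ⟨c', h1, h2, h3⟩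
      by_cases hcc : c' = c
      · subst hcc
        exact Or.inl ⟨h2, h3⟩
      · refine Or.inr ⟨c', ?_⟩
        simp only [Function.update_of_ne (hne c' hcc)]
        exact ⟨h1, h2, h3⟩
    · rintro (⟨h1, h2⟩ | ⟨c', h1, h2, h3⟩)
      · exact ⟨c, hc, h1, h2⟩
      · by_cases hcc : c' = c
        · subst hcc
          simp at h2
        · simp only [Function.update_of_ne (hne c' hcc)] at h1 h2 h3
          exact ⟨c', h1, h2, h3⟩
  · split_ifs with h1
    · rw [List.nodup_append]
      refine ⟨h.nodup, by simp, ?_⟩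
      intro a ha b hb
      rw [List.mem_singleton.1 hb]
      rintro rfl
      exact h.notMem_out c h1 ha
    · exact h.nodup
  · intro c' h1
    by_cases hcc : c' = c
    · subst hcc
      simp at h1
    · simp only [Function.update_of_ne (hne c' hcc)] at h1 ⊢
      rw [hmem]
      rintro (h2 | ⟨h2, h3⟩)
      · exact h.notMem_out c' h1 h2
      · exact hcc (h.pos_inj c c' h2 h3).symm
  · intro c' c'' h1 h2
    by_cases hcc : c' = c
    · subst hcc
      simp at h1
    · rw [Function.update_of_ne (hne c' hcc)] at h1 h2
      by_cases hcc' : c'' = c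
      · subst hcc'
        simp only [Function.update_self] at h2
        omega
      · rw [Function.update_of_ne (hne c'' hcc')] at h2
        exact h.pos_inj c' c'' h1 h2
  · intro c' h1
    by_cases hcc : c' = c
    · subst hcc
      simp at h1
    · rw [Function.update_of_ne (hne c' hcc)] at h1 ⊢
      exact h.len_pos c' h1

theorem LazyRel.activate_of_le {c : Fin σ} {l p : ℕ} (h : LazyRel n st len pos e out)
    (he : e c = 0) (hl : l + 1 ≤ len c) :
    LazyRel n (activate l p c st) len pos e out := by
  have h1 := h.entry c (by have := h.len_le c; omega)
  have : activate l p c st = st := by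
    rw [activate, if_neg]
    rw [h1]
    simp only []
    omega
  rwa [this]

theorem LazyRel.len_lt_iff {c : Fin σ} {l : ℕ} (h : LazyRel n st len pos e out)
    (he : e c = 0) : (st.R c).len < (l : ℤ) ↔ len c < l + 1 := by
  rw [h.entry c (by have := h.len_le c; omega)]
  simp only []
  omega

theorem LazyRel.activate_of_lt {c : Fin σ} {l p : ℕ} (h : LazyRel n st len pos e out)
    (he : e c = 0) (hl : len c < l + 1) (hln : l + 1 ≤ n) (hp : 0 < p) (hpS : p ∉ st.S)
    (hact : ∀ c', (st.R c').active = true → (st.R c').pos = p → c' = c) :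
    LazyRel n (activate l p c st) (Function.update len c (l + 1)) (Function.update pos c p) e
      out := by
  have hlen := (h.len_lt_iff he).2 hl
  have hne : ∀ c' : Fin σ, c' ≠ c → (c' : ℕ) ≠ c := fun c' h1 h2 => h1 (Fin.ext h2)
  have hpos : ∀ c' : Fin σ, c' ≠ c → pos c' ≠ p := by
    intro c' h1 h2
    by_cases h3 : n + 1 < len c' + e c'
    · exact hpS ((h.mem_S p).2 (Or.inr ⟨c', h3, by omega, h2⟩))
    · refine h1 (hact c' ?_ ?_) <;> rw [h.entry c' (by omega)]
      · simp only [decide_eq_true_eq]; omega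
      · exact h2
  have hcl := h.len_le c
  refine ⟨h.e_le, ?_, ?_, ?_, ?_, h.nodup, ?_, ?_, ?_⟩
  · intro c'
    have := h.len_le c'
    rw [Function.update_apply]
    split_ifs <;> omega
  · intro c' h1
    by_cases hcc : c' = c
    · subst hcc
      simp only [Function.update_self] at h1
      omega
    · rw [Function.update_of_ne (hne c' hcc)] at h1
      rw [activate_R, if_neg (fun h => hcc h.1)]
      exact h.entry_pending c' h1
  · intro c' h1
    by_cases hcc : c' = c
    · subst hcc
      rw [activate_R, if_pos ⟨rfl, hlen⟩]
      simp [hp]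
    · simp only [Function.update_of_ne (hne c' hcc)] at h1 ⊢
      rw [activate_R, if_neg (fun h => hcc h.1)]
      exact h.entry c' h1
  · intro x
    rw [activate_S, h.mem_S]
    refine or_congr_right (exists_congr fun c' => ?_)
    by_cases hcc : c' = c
    · subst hcc
      simp only [Function.update_self]
      constructor <;> (rintro ⟨h1, -⟩; omega)
    · simp only [Function.update_of_ne (hne c' hcc)]
  · intro c' h1
    by_cases hcc : c' = c
    · subst hcc
      rw [Function.update_self]
      exact fun h2 => hpS ((h.mem_S p).2 (Or.inl h2))
    · simp only [Function.update_of_ne (hne c' hcc)] at h1 ⊢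
      exact h.notMem_out c' h1
  · intro c' c'' h1 h2
    by_cases hcc : c' = c <;> by_cases hcc' : c'' = c
    · rw [hcc, hcc']
    · subst hcc
      rw [Function.update_self, Function.update_of_ne (hne c'' hcc')] at h2
      exact absurd h2.symm (hpos c'' hcc')
    · subst hcc'
      rw [Function.update_self, Function.update_of_ne (hne c' hcc)] at h2
      exact absurd h2 (hpos c' hcc)
    · rw [Function.update_of_ne (hne c' hcc)] at h1 h2
      rw [Function.update_of_ne (hne c'' hcc')] at h2
      exact h.pos_inj c' c'' h1 h2
  · intro c' h1
    by_cases hcc : c' = c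
    · subst hcc
      simp
    · rw [Function.update_of_ne (hne c' hcc)] at h1 ⊢
      exact h.len_pos c' h1

theorem LazyRel.finish (h : LazyRel n st len pos e out) :
    (out ++ ((List.range σ).map pos).filter (fun x => 0 < x)).Nodup ∧
      (out ++ ((List.range σ).map pos).filter (fun x => 0 < x)).toFinset =
        (Suffixient.eval (-1) st).S := by
  constructor
  · rw [List.nodup_append]
    refine ⟨h.nodup, ?_, ?_⟩
    · rw [List.filter_map]
      refine List.Nodup.map_on ?_ (List.nodup_range.filter _)
      intro x hx y hy hxy
      simp only [List.mem_filter, List.mem_range, Function.comp, decide_eq_true_eq] at hx hy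
      exact congrArg Fin.val (h.pos_inj ⟨x, hx.1⟩ ⟨y, hy.1⟩ hx.2 hxy)
    · rintro a ha b hb rfl
      simp only [List.mem_filter, List.mem_map, List.mem_range, decide_eq_true_eq] at hb
      obtain ⟨⟨c, hc, rfl⟩, h2⟩ := hb
      exact h.notMem_out ⟨c, hc⟩ h2 ha
  · ext x
    simp only [List.mem_toFinset, List.mem_append, List.mem_filter, List.mem_map, List.mem_range,
      decide_eq_true_eq]
    rw [mem_eval_S, h.mem_S]
    constructor
    · rintro (h1 | ⟨⟨c, hc, rfl⟩, h1⟩)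
      · exact Or.inl (Or.inl h1)
      · by_cases h2 : n + 1 < len c + e c
        · exact Or.inl (Or.inr ⟨⟨c, hc⟩, h2, h1, rfl⟩)
        · refine Or.inr ⟨⟨c, hc⟩, ?_⟩
          rw [h.entry ⟨c, hc⟩ (not_lt.1 h2)]
          have h3 := h.len_pos ⟨c, hc⟩ h1
          simp only [decide_eq_true_eq, and_true, h1] at h3 ⊢
          omega
    · rintro ((h1 | ⟨c, h1, h2, h3⟩) | ⟨c, h1, h2, h3⟩)
      · exact Or.inl h1
      · exact Or.inr ⟨⟨c, c.2, h3⟩, by omega⟩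
      · by_cases h4 : n + 1 < len c + e c
        · rw [h.entry_pending c h4] at h2
          exact absurd h2 (by simp)
        · rw [h.entry c (not_lt.1 h4)] at h2 h3
          simp only [decide_eq_true_eq] at h2 h3
          exact Or.inr ⟨⟨c, c.2, h3⟩, by omega⟩

end Lazy

/-! ### Reasoning about programs -/

section Run

/-- Store `v` in the memory cell `a`. -/
def State.setMem (s : State) (a v : ℕ) : State :=
  { s with mem := Function.update s.mem a v }

variable {W M : ℕ}

theorem State.set_reg (s : State) (x v y : ℕ) :
    (s.set x v).reg y = if y = x then v else s.reg y := by
  simp [State.set, Function.update_apply]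

theorem State.set_mem (s : State) (x v : ℕ) : (s.set x v).mem = s.mem := rfl

theorem State.set_inp (s : State) (x v : ℕ) : (s.set x v).inp = s.inp := rfl

theorem State.set_out (s : State) (x v : ℕ) : (s.set x v).out = s.out := rfl

theorem State.setMem_reg (s : State) (a v : ℕ) : (s.setMem a v).reg = s.reg := rfl

theorem State.setMem_mem (s : State) (a v : ℕ) :
    (s.setMem a v).mem = Function.update s.mem a v := rfl

variable (W M) in
/-- The program halts, and the number of steps and the final state satisfy `Q`. -/
def Run (p : Prog) (s : State) (Q : ℕ → State → Prop) : Prop :=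
  ∃ t s', Exec W M p s t s' ∧ Q t s'

theorem Run.imp {p : Prog} {s : State} {Q Q' : ℕ → State → Prop} (h : Run W M p s Q)
    (hQ : ∀ t s', Q t s' → Q' t s') : Run W M p s Q' := by
  obtain ⟨t, s', h1, h2⟩ := h
  exact ⟨t, s', h1, hQ t s' h2⟩

theorem run_skip {s : State} {Q : ℕ → State → Prop} : Run W M .skip s Q ↔ Q 1 s := by
  constructor
  · rintro ⟨t, s', h1, h2⟩; cases h1; exact h2
  · exact fun h => ⟨_, _, .skip s, h⟩

theorem run_const {s : State} {x k : ℕ} {Q : ℕ → State → Prop} :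
    Run W M (.const x k) s Q ↔ k < W ∧ Q 1 (s.set x k) := by
  constructor
  · rintro ⟨t, s', h1, h2⟩; cases h1; exact ⟨‹_›, h2⟩
  · exact fun h => ⟨_, _, .const s x k h.1, h.2⟩

theorem run_copy {s : State} {x y : ℕ} {Q : ℕ → State → Prop} :
    Run W M (.copy x y) s Q ↔ Q 1 (s.set x (s.reg y)) := by
  constructor
  · rintro ⟨t, s', h1, h2⟩; cases h1; exact h2
  · exact fun h => ⟨_, _, .copy s x y, h⟩

theorem run_add {s : State} {x y z : ℕ} {Q : ℕ → State → Prop} :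
    Run W M (.add x y z) s Q ↔
      s.reg y + s.reg z < W ∧ Q 1 (s.set x (s.reg y + s.reg z)) := by
  constructor
  · rintro ⟨t, s', h1, h2⟩; cases h1; exact ⟨‹_›, h2⟩
  · exact fun h => ⟨_, _, .add s x y z h.1, h.2⟩

theorem run_sub {s : State} {x y z : ℕ} {Q : ℕ → State → Prop} :
    Run W M (.sub x y z) s Q ↔ Q 1 (s.set x (s.reg y - s.reg z)) := by
  constructor
  · rintro ⟨t, s', h1, h2⟩; cases h1; exact h2
  · exact fun h => ⟨_, _, .sub s x y z, h⟩

theorem run_load {s : State} {x y : ℕ} {Q : ℕ → State → Prop} :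
    Run W M (.load x y) s Q ↔ s.reg y < M ∧ Q 1 (s.set x (s.mem (s.reg y))) := by
  constructor
  · rintro ⟨t, s', h1, h2⟩; cases h1; exact ⟨‹_›, h2⟩
  · exact fun h => ⟨_, _, .load s x y h.1, h.2⟩

theorem run_store {s : State} {x y : ℕ} {Q : ℕ → State → Prop} :
    Run W M (.store x y) s Q ↔ s.reg x < M ∧ Q 1 (s.setMem (s.reg x) (s.reg y)) := by
  constructor
  · rintro ⟨t, s', h1, h2⟩; cases h1; exact ⟨‹_›, h2⟩
  · exact fun h => ⟨_, _, .store s x y h.1, h.2⟩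

theorem run_write {s : State} {x : ℕ} {Q : ℕ → State → Prop} :
    Run W M (.write x) s Q ↔ Q 1 { s with out := s.out ++ [s.reg x] } := by
  constructor
  · rintro ⟨t, s', h1, h2⟩; cases h1; exact h2
  · exact fun h => ⟨_, _, .write s x, h⟩

theorem run_read {s : State} {x y z a b c : ℕ} {rest : List (ℕ × ℕ × ℕ)}
    {Q : ℕ → State → Prop} (h : s.inp = (a, b, c) :: rest) (ha : a < W) (hb : b < W) (hc : c < W)
    (hQ : Q 1 { ((s.set x a).set y b).set z c with inp := rest }) :
    Run W M (.read x y z) s Q :=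
  ⟨_, _, .read s x y z a b c rest h ha hb hc, hQ⟩

theorem run_seq {s : State} {p q : Prog} {Q : ℕ → State → Prop} :
    Run W M (.seq p q) s Q ↔
      Run W M p s (fun t s' => Run W M q s' (fun t' s'' => Q (t + t') s'')) := by
  constructor
  · rintro ⟨t, s', h1, h2⟩
    cases h1 with
    | seq _ _ _ s1 _ t1 t2 h3 h4 => exact ⟨t1, s1, h3, t2, s', h4, h2⟩
  · rintro ⟨t, s', h1, t', s'', h2, h3⟩
    exact ⟨_, _, .seq p q s s' s'' t t' h1 h2, h3⟩

theorem run_ite {s : State} {x y : ℕ} {p q : Prog} {Q : ℕ → State → Prop} :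
    Run W M (.ite x y p q) s Q ↔
      if s.reg x < s.reg y then Run W M p s (fun t s' => Q (t + 1) s')
      else Run W M q s (fun t s' => Q (t + 1) s') := by
  constructor
  · rintro ⟨t, s', h1, h2⟩
    cases h1 with
    | ite_true _ _ _ _ _ _ t h h1 => rw [if_pos h]; exact ⟨t, s', h1, h2⟩
    | ite_false _ _ _ _ _ _ t h h1 => rw [if_neg h]; exact ⟨t, s', h1, h2⟩
  · split_ifs with h
    · rintro ⟨t, s', h1, h2⟩
      exact ⟨_, _, .ite_true x y p q s s' t h h1, h2⟩
    · rintro ⟨t, s', h1, h2⟩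
      exact ⟨_, _, .ite_false x y p q s s' t h h1, h2⟩

/-- A loop with the invariant `I`, whose iteration of index `i` takes at most `f i` steps. -/
theorem run_loop {x y : ℕ} {p : Prog} (I : ℕ → State → Prop) (f : ℕ → ℕ) (a e : ℕ) (hae : a ≤ e)
    (hstep : ∀ i s, a ≤ i → i < e → I i s →
      s.reg x < s.reg y ∧ Run W M p s (fun t s' => t ≤ f i ∧ I (i + 1) s'))
    (hend : ∀ s, I e s → ¬ s.reg x < s.reg y) {s : State} (hs : I a s) :
    Run W M (.loop x y p) s
      (fun t s' => t ≤ ∑ i ∈ Finset.Ico a e, (f i + 1) + 1 ∧ I e s') := by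
  induction hd : e - a generalizing a s with
  | zero =>
    obtain rfl : a = e := by omega
    exact ⟨1, s, .loop_false x y p s (hend s hs), by simp, hs⟩
  | succ d ih =>
    obtain ⟨h1, t, s', h2, h3, h4⟩ := hstep a s le_rfl (by omega) hs
    obtain ⟨t', s'', h5, h6, h7⟩ := ih (a + 1) (by omega)
      (fun i s h => hstep i s (by omega)) h4 (by omega)
    refine ⟨_, s'', .loop_true x y p s s' s'' t t' h1 h2 h5, ?_, h7⟩
    rw [Finset.sum_eq_sum_Ico_succ_bot (by omega)]
    omega

/-- `memory[a] := max(memory[a], v)`, with the auxiliary register `t`. -/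
def Prog.storeMax (a v t : ℕ) : Prog :=
  .seq (.load t a) (.ite t v (.store a v) .skip)

theorem run_storeMax {s : State} {a v t : ℕ} {Q : ℕ → State → Prop} (ha : a ≠ t) (hv : v ≠ t) :
    Run W M (.storeMax a v t) s Q ↔ s.reg a < M ∧
      Q 3 ((s.set t (s.mem (s.reg a))).setMem (s.reg a) (max (s.mem (s.reg a)) (s.reg v))) := by
  simp only [Prog.storeMax, run_seq, run_load, run_ite, run_store, run_skip, State.set_reg,
    if_neg ha, if_neg hv, if_pos]
  refine and_congr_right fun h => ?_
  split_ifs with h1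
  · simp [max_eq_right h1.le, h]
  · rw [max_eq_left (not_lt.1 h1)]
    simp only [State.setMem, State.set_mem, Function.update_eq_self]
    rfl

end Run

/-! ### A tree of delayed updates

The nodes of a binary tree are numbered as in a heap, and the value of a node is the maximum of the
numbers stored at the node and at its ancestors. -/

section Tree

/-- The maximum of the numbers stored at the node `u` and its ancestors. -/
def up (D : ℕ → ℕ) : ℕ → ℕ
  | 0 => 0
  | u + 1 => max (D (u + 1)) (up D ((u + 1) / 2))
decreasing_by omega

theorem up_of_pos (D : ℕ → ℕ) {u : ℕ} (hu : 0 < u) : up D u = max (D u) (up D (u / 2)) := by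
  obtain ⟨v, rfl⟩ : ∃ v, u = v + 1 := ⟨u - 1, by omega⟩
  rw [up]

theorem up_zero (D : ℕ → ℕ) : up D 0 = 0 := by
  rw [up]

theorem up_congr {D D' : ℕ → ℕ} (u : ℕ) (h : ∀ v, 0 < v → v ≤ u → D v = D' v) :
    up D u = up D' u := by
  induction u using Nat.strong_induction_on with
  | _ u ih =>
    rcases Nat.eq_zero_or_pos u with rfl | hu
    · rw [up_zero, up_zero]
    · rw [up_of_pos D hu, up_of_pos D' hu, h u hu le_rfl,
        ih (u / 2) (by omega) (fun v h1 h2 => h v h1 (by omega))]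

theorem up_eq_zero {D : ℕ → ℕ} (hD : ∀ v, D v = 0) (u : ℕ) : up D u = 0 := by
  induction u using Nat.strong_induction_on with
  | _ u ih =>
    rcases Nat.eq_zero_or_pos u with rfl | hu
    · rw [up_zero]
    · rw [up_of_pos D hu, hD, ih (u / 2) (by omega), max_self]

theorem up_update_one (D : ℕ → ℕ) (d : ℕ) {u : ℕ} (hu : 0 < u) :
    up (Function.update D 1 (max (D 1) d)) u = max d (up D u) := by
  induction u using Nat.strong_induction_on with
  | _ u ih =>
    rw [up_of_pos _ hu, up_of_pos D hu]
    by_cases h1 : u = 1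
    · subst h1
      simp [up_zero, max_comm]
    · rw [ih (u / 2) (by omega) (by omega), Function.update_of_ne h1, max_left_comm]

/-- Move the number stored at the node `v` to its children. -/
def pushDown (D : ℕ → ℕ) (v : ℕ) : ℕ → ℕ :=
  Function.update (Function.update (Function.update D v 0) (2 * v) (max (D (2 * v)) (D v)))
    (2 * v + 1) (max (D (2 * v + 1)) (D v))

theorem up_pushDown (D : ℕ → ℕ) {v : ℕ} (hv : 0 < v) {u : ℕ} (hu : u ≠ v) :
    up (pushDown D v) u = up D u := by
  induction u using Nat.strong_induction_on with
  | _ u ih =>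
    rcases Nat.eq_zero_or_pos u with rfl | hu0
    · rw [up_zero, up_zero]
    · rw [up_of_pos _ hu0, up_of_pos D hu0]
      by_cases h1 : u / 2 = v
      · have h2 : pushDown D v u = max (D u) (D v) := by
          rcases (show u = 2 * v ∨ u = 2 * v + 1 by omega) with rfl | rfl
          · rw [pushDown, Function.update_of_ne (by omega), Function.update_self]
          · rw [pushDown, Function.update_self]
        have h3 : pushDown D v v = 0 := by
          rw [pushDown, Function.update_of_ne (by omega), Function.update_of_ne (by omega),
            Function.update_self]
        rw [h1, h2, up_of_pos _ hv, up_of_pos D hv, h3, ih (v / 2) (by omega) (by omega)]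
        simp [max_assoc]
      · rw [ih (u / 2) (by omega) h1, pushDown, Function.update_of_ne (by omega),
          Function.update_of_ne (by omega), Function.update_of_ne (by omega)]

theorem up_pushDown_self (D : ℕ → ℕ) {v : ℕ} (hv : 0 < v) (h : up D (v / 2) = 0) :
    up (pushDown D v) v = 0 := by
  rw [up_of_pos _ hv, up_pushDown D hv (by omega), h, pushDown, Function.update_of_ne (by omega),
    Function.update_of_ne (by omega), Function.update_self, max_self]

end Tree

/-! ### The program

The registers `0` to `7` hold the constants `n`, `σ`, `1`, `N`, `2n`, `6n`, `7n` and `0`, where `N` is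
the least power of two with `σ ≤ N`. The memory holds `q / 2` in the cell `q` for the powers of two
`2 ≤ q ≤ N`, the tree of delayed updates from the cell `2n` on, whose leaf for the character `c` is
the node `N + c`, and the lengths and the positions of the table from the cells `6n` and `7n` on. -/

section Program

/-- Move the number stored at the node in register `20` to its children, and go on to one of them. -/
def descendStep : Prog :=
  .seq (.load 22 22) <|
  .seq (.add 23 4 20) <| .seq (.load 24 23) <| .seq (.store 23 7) <|
  .seq (.add 20 20 20) <|
  .seq (.add 23 4 20) <| .seq (.storeMax 23 24 25) <|
  .seq (.add 23 23 2) <| .seq (.storeMax 23 24 25) <|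
  .ite 21 22 .skip (.seq (.add 20 20 2) (.sub 21 21 22))

/-- Move all numbers stored at the ancestors of the leaf of the character in register `15` down
the path to this leaf, and leave the leaf in register `20`. -/
def descend : Prog :=
  .seq (.const 20 1) <| .seq (.copy 21 15) <| .seq (.copy 22 3) <|
  .loop 2 22 descendStep

/-- Apply the delayed update at the leaf in register `20` to the entry of the character in register
`15`, and leave the addresses of the entry in the registers `26` and `27` and its length in
register `28`. -/
def flush : Prog :=
  .seq (.add 23 4 20) <| .seq (.load 24 23) <| .seq (.store 23 7) <|
  .seq (.add 25 0 2) <| .seq (.sub 25 25 24) <|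
  .seq (.add 26 5 15) <| .seq (.add 27 6 15) <| .seq (.load 28 26) <|
  .ite 25 28
    (.seq (.load 29 27) <| .seq (.ite 7 29 (.write 29) .skip) <|
      .seq (.store 27 7) <| .seq (.store 26 25) (.copy 28 25))
    .skip

/-- Activate the entry of the character in register `15` with the position in register `16` and the
length in register `17`. -/
def touch : Prog :=
  .seq descend <| .seq flush <|
  .ite 28 17 (.seq (.store 26 17) (.store 27 16)) .skip

/-- Process the run boundary between the triples in the registers `9`, `10` and `11`, `12`, `13`. -/
def boundary : Prog :=
  .seq (.add 18 4 2) <| .seq (.storeMax 18 14 19) <| .seq (.const 14 0) <|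
  .seq (.add 17 12 2) <|
  .seq (.copy 15 9) <| .seq (.sub 16 0 10) <| .seq (.add 16 16 2) <| .seq touch <|
  .seq (.copy 15 11) <| .seq (.sub 16 0 13) <| .seq (.add 16 16 2) touch

/-- Read the next triple, and update the delayed update in register `14`. -/
def fetch : Prog :=
  .seq (.read 11 12 13) <| .seq (.sub 18 0 12) (.ite 14 18 (.copy 14 18) .skip)

/-- Process the next triple. -/
def iteration : Prog :=
  .seq fetch <|
  .seq (.ite 9 11 boundary (.ite 11 9 boundary .skip)) <|
  .seq (.copy 9 11) <| .seq (.copy 10 13) (.add 8 8 2)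

/-- Set up the constants and the table of halves. -/
def setup : Prog :=
  .seq (.const 2 1) <| .seq (.add 4 0 0) <| .seq (.add 5 4 4) <| .seq (.add 5 5 4) <|
  .seq (.add 6 5 0) <| .seq (.const 3 1) <|
  .loop 3 1 (.seq (.add 18 3 3) <| .seq (.store 18 3) (.copy 3 18))

/-- Output the positions of all active entries. -/
def finish : Prog :=
  .seq (.const 8 0) <|
  .loop 8 1 <|
    .seq (.add 18 6 8) <| .seq (.load 19 18) <| .seq (.ite 7 19 (.write 19) .skip) (.add 8 8 2)

/-- The one-pass algorithm. -/
def onePassProg : Prog :=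
  .seq setup <| .seq (.read 9 19 10) <| .seq (.const 8 1) <| .seq (.loop 8 0 iteration) finish

/-! ### Memory layout -/

/-- The memory holds the tree `D` and the table `len`, `pos`. -/
structure Layout (n K : ℕ) (mem D len pos : ℕ → ℕ) : Prop where
  half : ∀ k < K, mem (2 ^ (k + 1)) = 2 ^ k
  tree : ∀ v < 4 * n, mem (2 * n + v) = D v
  len : ∀ c < n, mem (6 * n + c) = len c
  pos : ∀ c < n, mem (7 * n + c) = pos c

/-- The registers `0` to `7` hold their constants. -/
structure Consts (n σ K : ℕ) (s : State) : Prop where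
  r0 : s.reg 0 = n
  r1 : s.reg 1 = σ
  r2 : s.reg 2 = 1
  r3 : s.reg 3 = 2 ^ K
  r4 : s.reg 4 = 2 * n
  r5 : s.reg 5 = 6 * n
  r6 : s.reg 6 = 7 * n
  r7 : s.reg 7 = 0

variable {n σ K W M : ℕ} {mem D len pos : ℕ → ℕ}

theorem Consts.of_eq {s s' : State} (h : Consts n σ K s) (hs : ∀ r < 8, s'.reg r = s.reg r) :
    Consts n σ K s' := by
  obtain ⟨h0, h1, h2, h3, h4, h5, h6, h7⟩ := h
  constructor <;> rw [hs _ (by norm_num)] <;> assumption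

theorem pow_succ_lt (hK : 2 ^ K < 2 * n) {k : ℕ} (hk : k < K) : 2 ^ (k + 1) < 2 * n :=
  (Nat.pow_le_pow_right (by norm_num) hk).trans_lt hK

theorem Layout.update_tree (h : Layout n K mem D len pos) (hK : 2 ^ K < 2 * n) {v : ℕ}
    (hv : v < 4 * n) (x : ℕ) :
    Layout n K (Function.update mem (2 * n + v) x) (Function.update D v x) len pos := by
  refine ⟨fun k hk => ?_, fun u hu => ?_, fun c hc => ?_, fun c hc => ?_⟩
  · have := pow_succ_lt hK hk
    rw [Function.update_of_ne (by omega), h.half k hk]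
  · rw [Function.update_apply, Function.update_apply, h.tree u hu]
    simp
  · rw [Function.update_of_ne (by omega), h.len c hc]
  · rw [Function.update_of_ne (by omega), h.pos c hc]

theorem Layout.update_len (h : Layout n K mem D len pos) (hK : 2 ^ K < 2 * n) {c : ℕ}
    (hc : c < n) (x : ℕ) :
    Layout n K (Function.update mem (6 * n + c) x) D (Function.update len c x) pos := by
  refine ⟨fun k hk => ?_, fun u hu => ?_, fun c hc => ?_, fun c hc => ?_⟩
  · have := pow_succ_lt hK hk
    rw [Function.update_of_ne (by omega), h.half k hk]
  · rw [Function.update_of_ne (by omega), h.tree u hu]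
  · rw [Function.update_apply, Function.update_apply, h.len c hc]
    simp
  · rw [Function.update_of_ne (by omega), h.pos c hc]

theorem Layout.update_pos (h : Layout n K mem D len pos) (hK : 2 ^ K < 2 * n) {c : ℕ}
    (hc : c < n) (x : ℕ) :
    Layout n K (Function.update mem (7 * n + c) x) D len (Function.update pos c x) := by
  refine ⟨fun k hk => ?_, fun u hu => ?_, fun c hc => ?_, fun c hc => ?_⟩
  · have := pow_succ_lt hK hk
    rw [Function.update_of_ne (by omega), h.half k hk]
  · rw [Function.update_of_ne (by omega), h.tree u hu]
  · rw [Function.update_of_ne (by omega), h.len c hc]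
  · rw [Function.update_apply, Function.update_apply, h.pos c hc]
    simp

/-- The machine is large enough for texts of length `n` and a tree with `2 ^ K` leaves. -/
structure Fits (n K W M : ℕ) : Prop where
  two_le : 2 ≤ n
  pow_lt : 2 ^ K < 2 * n
  word : 8 * n ≤ W
  mem : 8 * n ≤ M

/-- The registers below `r` and the input are the same. -/
def SameBelow (r : ℕ) (s s' : State) : Prop :=
  (∀ x < r, s'.reg x = s.reg x) ∧ s'.inp = s.inp

theorem SameBelow.trans {r : ℕ} {s s' s'' : State} (h : SameBelow r s s')
    (h' : SameBelow r s' s'') : SameBelow r s s'' :=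
  ⟨fun x hx => (h'.1 x hx).trans (h.1 x hx), h'.2.trans h.2⟩

theorem run_descend_step (hf : Fits n K W M) {s : State} (hs : Consts n σ K s)
    (hl : Layout n K s.mem D len pos) {v x k : ℕ} (hv : 0 < v) (hvK : v < 2 ^ K) (hk : k < K)
    (h20 : s.reg 20 = v) (h21 : s.reg 21 = x) (h22 : s.reg 22 = 2 ^ (k + 1)) :
    Run W M descendStep s (fun t s' => t ≤ 17 ∧ SameBelow 18 s s' ∧ s'.out = s.out ∧
      Layout n K s'.mem (pushDown D v) len pos ∧ s'.reg 22 = 2 ^ k ∧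
      (if x < 2 ^ k then s'.reg 20 = 2 * v ∧ s'.reg 21 = x
        else s'.reg 20 = 2 * v + 1 ∧ s'.reg 21 = x - 2 ^ k)) := by
  obtain ⟨hn, hK, hW, hM⟩ := hf
  have hp := pow_succ_lt hK hk
  have e1 : s.mem (2 ^ (k + 1)) = 2 ^ k := hl.half k hk
  have e2 : s.mem (2 * n + v) = D v := hl.tree v (by omega)
  have hl1 := hl.update_tree hK (v := v) (by omega) 0
  have e3 : Function.update s.mem (2 * n + v) 0 (2 * n + 2 * v) = D (2 * v) := by
    rw [hl1.tree (2 * v) (by omega), Function.update_of_ne (by omega)]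
  have hl2 := hl1.update_tree hK (v := 2 * v) (by omega) (max (D (2 * v)) (D v))
  have e4 : Function.update (Function.update s.mem (2 * n + v) 0) (2 * n + 2 * v)
      (max (D (2 * v)) (D v)) (2 * n + (2 * v + 1)) = D (2 * v + 1) := by
    rw [hl2.tree (2 * v + 1) (by omega), Function.update_of_ne (by omega),
      Function.update_of_ne (by omega)]
  have hl3 := hl2.update_tree hK (v := 2 * v + 1) (by omega) (max (D (2 * v + 1)) (D v))
  simp only [descendStep, run_seq, run_load, run_add, run_store, run_sub, run_ite, run_skip, State.set_reg,
    State.set_mem, State.setMem_reg, State.setMem_mem, h20, h21, h22, hs.r2, hs.r4, hs.r7, e1, e2,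
    ← Nat.two_mul, run_storeMax, ne_eq, Nat.reduceEqDiff, not_false_eq_true, ↓reduceIte,
    e3, e4, Nat.add_assoc (2 * n) (2 * v) 1]
  refine ⟨by omega, by omega, by omega, by omega, by omega, by omega, by omega, by omega,
    by omega, ?_⟩
  have hsame : ∀ x < 18, x ≠ 20 ∧ x ≠ 21 ∧ x ≠ 22 ∧ x ≠ 23 ∧ x ≠ 24 ∧ x ≠ 25 := by omega
  by_cases hx : x < 2 ^ k
  · simp only [if_pos hx]
    refine ⟨by omega, ⟨fun r hr => ?_, rfl⟩, rfl, hl3, by simp, by simp⟩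
    simp [hsame r hr, State.set_reg, State.setMem_reg]
  · simp only [if_neg hx]
    refine ⟨by omega, by omega, ⟨fun r hr => ?_, rfl⟩, rfl, hl3, by simp, by simp⟩
    simp [hsame r hr, State.set_reg, State.setMem_reg]

theorem run_descend (hf : Fits n K W M) {s : State} (hs : Consts n σ K s)
    (hl : Layout n K s.mem D len pos) {c : ℕ} (hc : c < 2 ^ K) (h15 : s.reg 15 = c) :
    Run W M descend s (fun t s' => t ≤ 18 * K + 4 ∧ SameBelow 18 s s' ∧ s'.out = s.out ∧
      s'.reg 20 = 2 ^ K + c ∧ ∃ D', Layout n K s'.mem D' len pos ∧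
        (∀ u, 2 ^ K ≤ u → up D' u = up D u) ∧ up D' ((2 ^ K + c) / 2) = 0) := by
  have hn := hf.two_le
  have hW := hf.word
  simp only [descend, run_seq, run_const, run_copy, State.set_reg, Nat.reduceEqDiff, ↓reduceIte,
    h15, hs.r3]
  refine ⟨by omega, ?_⟩
  let I : ℕ → State → Prop := fun h s' => SameBelow 18 s s' ∧ s'.out = s.out ∧
    s'.reg 22 = 2 ^ (K - h) ∧ s'.reg 20 * 2 ^ (K - h) + s'.reg 21 = 2 ^ K + c ∧
    s'.reg 21 < 2 ^ (K - h) ∧ ∃ D', Layout n K s'.mem D' len pos ∧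
      (∀ u, 2 ^ K ≤ u → up D' u = up D u) ∧ up D' (s'.reg 20 / 2) = 0
  refine (run_loop I (fun _ => 17) 0 K (Nat.zero_le _) ?_ ?_ ?_).imp ?_
  · rintro h s' - hh ⟨h1, h2, h3, h4, h5, D', h6, h7, h8⟩
    have hcs : Consts n σ K s' := hs.of_eq fun r hr => h1.1 r (by omega)
    obtain ⟨k, hk⟩ : ∃ k, K - h = k + 1 := ⟨K - h - 1, by omega⟩
    have hk' : K - (h + 1) = k := by omega
    rw [hk] at h3 h4 h5
    have hpk : 2 ^ (k + 1) ≤ 2 ^ K := Nat.pow_le_pow_right (by norm_num) (by omega)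
    have hpk' : 2 ^ (k + 1) = 2 * 2 ^ k := by rw [pow_succ, mul_comm]
    have hk1 : 1 ≤ 2 ^ k := Nat.one_le_two_pow
    generalize hv : s'.reg 20 = v at h4 h8
    generalize hx : s'.reg 21 = x at h4 h5
    have hv0 : 0 < v := by
      rcases Nat.eq_zero_or_pos v with rfl | h
      · omega
      · exact h
    have hvK : v < 2 ^ K := by
      by_contra hge
      have : 2 ^ K * 2 ≤ v * 2 ^ (k + 1) := Nat.mul_le_mul (not_lt.1 hge) (by omega)
      omega
    refine ⟨by rw [hcs.r2, h3]; omega, ?_⟩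
    refine (run_descend_step hf hcs h6 hv0 hvK (by omega) hv hx h3).imp ?_
    rintro t s'' ⟨g1, g2, g3, g4, g5, g6⟩
    refine ⟨g1, h1.trans g2, g3.trans h2, by rw [g5, hk'], ?_⟩
    rw [hk']
    have hup : ∀ u, 2 ^ K ≤ u → up (pushDown D' v) u = up D u := fun u hu => by
      rw [up_pushDown D' hv0 (by omega), h7 u hu]
    have hself := up_pushDown_self D' hv0 h8
    rw [hpk'] at h4 h5
    split_ifs at g6 with hxk
    · rw [g6.1, g6.2]
      refine ⟨by rw [← h4]; ring, hxk, _, g4, hup, ?_⟩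
      rwa [show 2 * v / 2 = v by omega]
    · rw [g6.1, g6.2]
      refine ⟨?_, by omega, _, g4, hup, ?_⟩
      · have : (2 * v + 1) * 2 ^ k = v * (2 * 2 ^ k) + 2 ^ k := by ring
        omega
      · rwa [show (2 * v + 1) / 2 = v by omega]
  · rintro s' ⟨h1, -, h3, -⟩
    rw [h1.1 2 (by norm_num), hs.r2, h3]
    simp
  · refine ⟨⟨fun r hr => ?_, rfl⟩, rfl, by simp [State.set_reg], ?_, ?_, D, hl, fun u _ => rfl, ?_⟩
    · simp only [State.set_reg]
      rw [if_neg (by omega), if_neg (by omega), if_neg (by omega)]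
    · simp [State.set_reg]
    · simpa [State.set_reg] using hc
    · simp [State.set_reg, up_zero]
  · rintro t s' ⟨h0, h1, h2, h3, h4, h5, D', h6, h7, h8⟩
    simp only [Finset.sum_const, Nat.card_Ico, smul_eq_mul] at h0
    simp only [Nat.sub_self, pow_zero] at h4 h5
    have h9 : s'.reg 20 = 2 ^ K + c := by omega
    rw [h9] at h8
    exact ⟨by omega, h1, h2, h9, D', h6, h7, h8⟩

theorem run_flush (hf : Fits n K W M) (hσ : σ ≤ n) (hσK : σ ≤ 2 ^ K) {s : State}
    (hs : Consts n σ K s) (hl : Layout n K s.mem D len pos) {st : OnePassState σ} {c : Fin σ}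
    (h15 : s.reg 15 = c) (h20 : s.reg 20 = 2 ^ K + c)
    (hrel : LazyRel n st len pos (fun c => up D (2 ^ K + c)) s.out)
    (hup : up D ((2 ^ K + c) / 2) = 0) :
    Run W M flush s (fun t s' => t ≤ 16 ∧ SameBelow 18 s s' ∧
      ∃ D' len' pos', Layout n K s'.mem D' len' pos' ∧
        LazyRel n st len' pos' (fun c => up D' (2 ^ K + c)) s'.out ∧ up D' (2 ^ K + c) = 0 ∧
        s'.reg 26 = 6 * n + c ∧ s'.reg 27 = 7 * n + c ∧ s'.reg 28 = len' c) := by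
  obtain ⟨hn, hK, hW, hM⟩ := hf
  have hc := c.2
  have hpos : 0 < 2 ^ K := by positivity
  have hD : up D (2 ^ K + c) = D (2 ^ K + c) := by
    rw [up_of_pos D (by omega), hup, max_eq_left (Nat.zero_le _)]
  have hDle : D (2 ^ K + c) ≤ n := hD ▸ hrel.e_le c
  set D' := Function.update D (2 ^ K + c) 0 with hD'
  have hlow : ∀ u, u < 2 ^ K → up D' u = up D u := fun u hu =>
    up_congr u fun v _ h2 => by rw [hD', Function.update_of_ne (by omega)]
  have hupc : up D' (2 ^ K + c) = 0 := by
    rw [up_of_pos D' (by omega), hlow _ (by omega), hup, hD', Function.update_self, max_self]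
  have he : ∀ c' : Fin σ, up D' (2 ^ K + c') =
      Function.update (fun c => up D (2 ^ K + c)) (c : ℕ) 0 (c' : ℕ) := by
    intro c'
    have := c'.2
    by_cases hcc : (c' : ℕ) = c
    · rw [hcc, Function.update_self, hupc]
    · rw [Function.update_of_ne hcc, up_of_pos D' (by omega), up_of_pos D (by omega),
        hlow _ (by omega), hD', Function.update_of_ne (by omega)]
  have hl1 := hl.update_tree hK (v := 2 ^ K + c) (by omega) 0
  rw [← hD'] at hl1
  have e1 : s.mem (2 * n + (2 ^ K + c)) = D (2 ^ K + c) := hl.tree _ (by omega)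
  have e2 := hl1.len c (by omega)
  have e3 := hl1.pos c (by omega)
  have hsame : ∀ x < 18, x ≠ 23 ∧ x ≠ 24 ∧ x ≠ 25 ∧ x ≠ 26 ∧ x ≠ 27 ∧ x ≠ 28 ∧ x ≠ 29 := by omega
  simp only [flush, run_seq, run_load, run_add, run_store, run_sub, run_ite, run_skip, run_copy,
    run_write, State.set_reg, State.set_mem, State.setMem_reg, State.setMem_mem, h20, h15, hs.r0,
    hs.r2, hs.r4, hs.r5, hs.r6, hs.r7, e1, e2, e3, Nat.reduceEqDiff, ↓reduceIte]
  refine ⟨by omega, by omega, by omega, by omega, by omega, by omega, by omega, ?_⟩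
  by_cases hlt : n + 1 < len c + D (2 ^ K + c)
  · rw [if_pos (by omega)]
    have hrel' := (hrel.flush_of_lt (c := c) (by simpa only [hD] using hlt)).congr (e' := fun c => up D' (2 ^ K + c))
      (fun _ => rfl) (fun _ => rfl) he
    simp only [hD] at hrel'
    have hl2 := (hl1.update_pos hK (c := c) (by omega) 0).update_len hK (c := c) (by omega)
      (n + 1 - D (2 ^ K + c))
    refine ⟨by omega, ?_⟩
    by_cases hp : 0 < pos c
    · rw [if_pos hp]
      rw [if_pos hp] at hrel'
      refine ⟨by omega, by omega, by omega, ⟨fun r hr => ?_, rfl⟩, _, _, _, hl2, hrel', hupc, ?_⟩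
      · simp [hsame r hr, State.set_reg, State.setMem_reg]
      · simp
    · rw [if_neg hp]
      rw [if_neg hp] at hrel'
      refine ⟨by omega, by omega, by omega, ⟨fun r hr => ?_, rfl⟩, _, _, _, hl2, hrel', hupc, ?_⟩
      · simp [hsame r hr, State.set_reg, State.setMem_reg]
      · simp
  · rw [if_neg (by omega)]
    have hrel' := (hrel.flush_of_le (c := c) (by simpa only [hD] using not_lt.1 hlt)).congr (e' := fun c => up D' (2 ^ K + c))
      (fun _ => rfl) (fun _ => rfl) he
    refine ⟨by omega, ⟨fun r hr => ?_, rfl⟩, _, _, _, hl1, hrel', hupc, ?_⟩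
    · simp [hsame r hr, State.set_reg, State.setMem_reg]
    · simp

theorem run_touch (hf : Fits n K W M) (hσ : σ ≤ n) (hσK : σ ≤ 2 ^ K) {s : State}
    (hs : Consts n σ K s) (hl : Layout n K s.mem D len pos) {st : OnePassState σ} {c : Fin σ}
    {l p : ℕ} (h15 : s.reg 15 = c) (h16 : s.reg 16 = p) (h17 : s.reg 17 = l + 1)
    (hrel : LazyRel n st len pos (fun c => up D (2 ^ K + c)) s.out) (hln : l < n) (hp : 0 < p)
    (hpS : (st.R c).len < (l : ℤ) → p ∉ st.S)
    (hact : ∀ c', (st.R c').active = true → (st.R c').pos = p → c' = c) :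
    Run W M touch s (fun t s' => t ≤ 18 * K + 23 ∧ SameBelow 18 s s' ∧
      ∃ D' len' pos', Layout n K s'.mem D' len' pos' ∧
        LazyRel n (activate l p c st) len' pos' (fun c => up D' (2 ^ K + c)) s'.out) := by
  have hc := c.2
  rw [touch, run_seq]
  refine (run_descend hf hs hl (c := c) (by omega) h15).imp ?_
  rintro t1 s1 ⟨a1, a2, a3, a4, D1, a5, a6, a7⟩
  have hs1 : Consts n σ K s1 := hs.of_eq fun r hr => a2.1 r (by omega)
  have hrel1 : LazyRel n st len pos (fun c => up D1 (2 ^ K + c)) s1.out := by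
    rw [a3]
    exact hrel.congr (fun _ => rfl) (fun _ => rfl) fun c => a6 _ (by omega)
  rw [run_seq]
  refine (run_flush hf hσ hσK hs1 a5 ((a2.1 15 (by norm_num)).trans h15) a4 hrel1 a7).imp ?_
  rintro t2 s2 ⟨b1, b2, D2, len2, pos2, b3, b4, b5, b6, b7, b8⟩
  have hb := a2.trans b2
  have r17 : s2.reg 17 = l + 1 := (hb.1 17 (by norm_num)).trans h17
  have r16 : s2.reg 16 = p := (hb.1 16 (by norm_num)).trans h16
  obtain ⟨hn, hK, hW, hM⟩ := hf
  simp only [run_seq, run_store, run_ite, run_skip, State.setMem_reg, b6, b7, b8, r16, r17]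
  split_ifs with h
  · refine ⟨by omega, by omega, by omega, hb, D2, _, _,
      (b3.update_len hK (c := c) (by omega) (l + 1)).update_pos hK (c := c) (by omega) p, ?_⟩
    exact b4.activate_of_lt b5 h hln hp (hpS ((b4.len_lt_iff b5).2 h)) hact
  · exact ⟨by omega, hb, D2, _, _, b3, b4.activate_of_le b5 (by omega)⟩

theorem run_boundary (hf : Fits n K W M) (hσ : σ ≤ n) (hσK : σ ≤ 2 ^ K) {s : State}
    (hs : Consts n σ K s) (hl : Layout n K s.mem D len pos) {st : OnePassState σ} {a b : Fin σ}
    {l u v d : ℕ} (h9 : s.reg 9 = a) (h10 : s.reg 10 = u) (h11 : s.reg 11 = b)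
    (h12 : s.reg 12 = l) (h13 : s.reg 13 = v) (h14 : s.reg 14 = d)
    (hrel : LazyRel n st len pos (fun c => max d (up D (2 ^ K + c))) s.out) (hln : l < n)
    (hab : a ≠ b) (hp : n - u + 1 ≠ n - v + 1)
    (hpS : (st.R a).len < (l : ℤ) → n - u + 1 ∉ st.S)
    (hqS : (st.R b).len < (l : ℤ) → n - v + 1 ∉ st.S)
    (hact : ∀ c, (st.R c).active = true → (st.R c).pos = n - u + 1 → c = a)
    (hact' : ∀ c, (st.R c).active = true → (st.R c).pos = n - v + 1 → c = b) :
    Run W M boundary s (fun t s' => t ≤ 36 * K + 58 ∧ SameBelow 14 s s' ∧ s'.reg 14 = 0 ∧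
      ∃ D' len' pos', Layout n K s'.mem D' len' pos' ∧
        LazyRel n (activate l (n - v + 1) b (activate l (n - u + 1) a st)) len' pos'
          (fun c => up D' (2 ^ K + c)) s'.out) := by
  obtain ⟨hn, hK, hW, hM⟩ := id hf
  have e1 := hl.tree 1 (by omega)
  simp only [boundary, run_seq, run_add, run_storeMax, run_const, run_copy, run_sub, State.set_reg,
    State.setMem_reg, State.set_mem, ne_eq, Nat.reduceEqDiff, not_false_eq_true,
    ↓reduceIte, hs.r0, hs.r2, hs.r4, h9, h10, h12, h14, e1]
  refine ⟨by omega, by omega, by omega, by omega, by omega, ?_⟩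
  have hsame : ∀ x < 14, x ≠ 14 ∧ x ≠ 15 ∧ x ≠ 16 ∧ x ≠ 17 ∧ x ≠ 18 ∧ x ≠ 19 := by omega
  refine (run_touch hf hσ hσK (c := a) (l := l) (p := n - u + 1) (st := st)
    (hs.of_eq fun r hr => ?_) (hl.update_tree hK (v := 1) (by omega) (max (D 1) d))
    (by simp [State.set_reg]) (by simp [State.set_reg]) (by simp [State.set_reg]) ?_ hln
    (by omega) hpS hact).imp ?_
  · simp [hsame r (by omega), State.set_reg, State.setMem_reg]
  · exact hrel.congr (fun _ => rfl) (fun _ => rfl) fun c =>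
      up_update_one D d (u := 2 ^ K + c) (by positivity)
  rintro t1 s1 ⟨a1, a2, D1, len1, pos1, a3, a4⟩
  have hlow : SameBelow 14 s s1 := by
    refine ⟨fun r hr => ?_, a2.2⟩
    rw [a2.1 r (by omega)]
    simp [hsame r hr, State.set_reg, State.setMem_reg]
  have r17 : s1.reg 17 = l + 1 := by
    rw [a2.1 17 (by norm_num)]
    simp [State.set_reg]
  have r14 : s1.reg 14 = 0 := by
    rw [a2.1 14 (by norm_num)]
    simp [State.set_reg]
  have hs1 : Consts n σ K s1 := hs.of_eq fun r hr => hlow.1 r (by omega)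
  have hba : b ≠ a := hab.symm
  simp only [hlow.1 11 (by norm_num), hlow.1 13 (by norm_num), h11, h13, hs1.r0, hs1.r2]
  refine ⟨by omega, ?_⟩
  refine (run_touch hf hσ hσK (c := b) (l := l) (p := n - v + 1)
    (st := activate l (n - u + 1) a st) (hs1.of_eq fun r hr => ?_) (by exact a3)
    (by simp [State.set_reg]) (by simp [State.set_reg]) (by simp [State.set_reg, r17]) (by exact a4) hln
    (by omega) ?_ ?_).imp ?_
  · simp [hsame r (by omega), State.set_reg]
  · rw [activate_R, if_neg (fun h => hba h.1), activate_S]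
    exact hqS
  · intro c
    rw [activate_R]
    split_ifs with h
    · intro _ h2
      exact absurd h2 hp
    · exact hact' c
  rintro t2 s2 ⟨b1, b2, b3⟩
  refine ⟨by omega, hlow.trans ⟨fun r hr => ?_, b2.2⟩, ?_, b3⟩
  · rw [b2.1 r (by omega)]
    simp [hsame r (by omega), State.set_reg]
  · rw [b2.1 14 (by norm_num)]
    simp [State.set_reg, r14]

/-- The invariant of the main loop, before the triple of index `i` is read. -/
structure MainInv (n σ K : ℕ) (b : ℕ → Fin σ) (L u : ℕ → ℕ) (i : ℕ) (s : State) : Prop where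
  consts : Consts n σ K s
  r8 : s.reg 8 = i
  r9 : s.reg 9 = b (i - 1)
  r10 : s.reg 10 = u (i - 1)
  inp : s.inp = (List.range' i (n - i)).map (fun k => ((b k : ℕ), L k, u k))
  data : ∃ D len pos, Layout n K s.mem D len pos ∧
    LazyRel n (eagerState b L (fun k => n - u k + 1) (i - 1)) len pos
      (fun c => max (s.reg 14) (up D (2 ^ K + c))) s.out

theorem run_fetch {s : State} {a l v : ℕ} {rest : List (ℕ × ℕ × ℕ)}
    (hinp : s.inp = (a, l, v) :: rest) (h0 : s.reg 0 = n) (ha : a < W) (hl : l < W) (hv : v < W) :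
    Run W M fetch s (fun t s' => t ≤ 4 ∧ (∀ r < 11, s'.reg r = s.reg r) ∧ s'.reg 11 = a ∧
      s'.reg 12 = l ∧ s'.reg 13 = v ∧ s'.reg 14 = max (s.reg 14) (n - l) ∧ s'.mem = s.mem ∧
      s'.inp = rest ∧ s'.out = s.out) := by
  rw [fetch, run_seq]
  refine run_read hinp ha hl hv ?_
  have hsame : ∀ x < 11, x ≠ 11 ∧ x ≠ 12 ∧ x ≠ 13 ∧ x ≠ 14 ∧ x ≠ 18 := by omega
  simp only [run_seq, run_sub, run_ite, run_copy, run_skip, State.set_reg, Nat.reduceEqDiff,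
    ↓reduceIte, h0]
  split_ifs with h1
  · refine ⟨by omega, fun r hr => ?_, ?_⟩
    · simp [hsame r hr]
    · simp [max_eq_right h1.le, State.set_mem, State.set_out, State.set_inp]
  · refine ⟨by omega, fun r hr => ?_, ?_⟩
    · simp [hsame r hr]
    · simp [max_eq_left (not_lt.1 h1), State.set_mem, State.set_out, State.set_inp]

theorem run_iteration (hf : Fits n K W M) (hσ : σ ≤ n) (hσK : σ ≤ 2 ^ K) {b : ℕ → Fin σ}
    {L u : ℕ → ℕ} (hL : ∀ k, 0 < k → k < n → L k < n) (hu1 : ∀ k < n, 1 ≤ u k)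
    (hun : ∀ k < n, u k ≤ n) (hinj : ∀ k < n, ∀ k' < n, u k = u k' → k = k') {i : ℕ} (hi : 0 < i)
    (hin : i < n) {s : State} (h : MainInv n σ K b L u i s) :
    Run W M iteration s (fun t s' =>
      t ≤ 12 + (if b i ≠ b (i - 1) then 36 * K + 58 else 0) ∧ MainInv n σ K b L u (i + 1) s') := by
  obtain ⟨hs, h8, h9, h10, hinp, D, len, pos, hl, hrel⟩ := h
  obtain ⟨hn, hK, hW, hM⟩ := id hf
  obtain ⟨i, rfl⟩ : ∃ k, i = k + 1 := ⟨i - 1, by omega⟩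
  simp only [Nat.add_sub_cancel] at h9 h10 hrel ⊢
  set p : ℕ → ℕ := fun k => n - u k + 1 with hp
  have hpinj : ∀ k < n, ∀ k' < n, p k = p k' → k = k' := by
    intro k hk k' hk' h
    have := hun k hk
    have := hun k' hk'
    have h1 := hu1 k hk
    have h2 := hu1 k' hk'
    simp only [hp] at h
    exact hinj k hk k' hk' (by omega)
  have hLi := hL (i + 1) hi hin
  have hb := (b (i + 1)).2
  have hui := hun (i + 1) hin
  have hui' := hun i (by omega)
  rw [show n - (i + 1) = (n - (i + 2)) + 1 by omega, List.range'_succ, List.map_cons] at hinp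
  rw [iteration, run_seq]
  refine (run_fetch hinp hs.r0 (by omega) (by omega) (by omega)).imp ?_
  rintro t1 s1 ⟨at1, a1, a11, a12, a13, a14, amem, ainp, aout⟩
  have hs1 : Consts n σ K s1 := hs.of_eq fun r hr => a1 r (by omega)
  rw [← amem] at hl
  have a9 : s1.reg 9 = b i := (a1 9 (by norm_num)).trans h9
  have a10 : s1.reg 10 = u i := (a1 10 (by norm_num)).trans h10
  have hE := eagerInv (b := b) (L := L) (p := p) i
  set E := eagerState b L p i with hEdef
  have hrel1 : LazyRel n (eval (L (i + 1)) E) len pos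
      (fun c => max (s1.reg 14) (up D (2 ^ K + c))) s1.out := by
    rw [aout]
    refine (hrel.eval hLi.le).congr (fun _ => rfl) (fun _ => rfl) fun c => ?_
    rw [a14, max_right_comm]
  have mid : Run W M (.ite 9 11 boundary (.ite 11 9 boundary .skip)) s1 (fun t s' =>
      t ≤ 3 + (if b (i + 1) ≠ b i then 36 * K + 58 else 0) ∧ SameBelow 14 s1 s' ∧
      ∃ D len pos, Layout n K s'.mem D len pos ∧
        LazyRel n (eagerStep b L p (i + 1) E) len pos
          (fun c => max (s'.reg 14) (up D (2 ^ K + c))) s'.out) := by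
    by_cases hbb : b (i + 1) ≠ b i
    · have hactive : ∀ k < n, ∀ c, ((eval (L (i + 1)) E).R c).active = true →
          ((eval (L (i + 1)) E).R c).pos = p k → c = b k := by
        intro k hk c h1 h2
        rw [eval_R, evalEntry] at h1 h2
        split_ifs at h1 h2
        obtain ⟨j, k', h3, h4, -⟩ := hE.of_active c h1
        have h5 := h3.cand.2.2.1
        have h6 := h3.le
        rw [← h3.cand.2.2.2, hpinj k' (by omega) k hk (h4.symm.trans h2)]
      have hbd := run_boundary (M := M) hf hσ hσK hs1 hl a9 a10 a11 a12 a13 rfl hrel1 hLi hbb.symm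
        (fun h => by have := hpinj i (by omega) (i + 1) hin h; omega)
        (fun h => hE.notMem_S hin hpinj ⟨hi, hbb, Or.inr rfl, rfl⟩ h)
        (fun h => hE.notMem_S hin hpinj ⟨hi, hbb, Or.inl rfl, rfl⟩ h)
        (hactive i (by omega)) (hactive (i + 1) hin)
      have hbd' : Run W M boundary s1 (fun t s' => t ≤ 36 * K + 58 ∧ SameBelow 14 s1 s' ∧
          ∃ D len pos, Layout n K s'.mem D len pos ∧
            LazyRel n (eagerStep b L p (i + 1) E) len pos
              (fun c => max (s'.reg 14) (up D (2 ^ K + c))) s'.out) := by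
        refine hbd.imp ?_
        rintro t s' ⟨c1, c2, c3, D', len', pos', c4, c5⟩
        refine ⟨c1, c2, D', len', pos', c4, ?_⟩
        rw [eagerStep, Nat.add_sub_cancel, if_pos hbb]
        exact c5.congr (fun _ => rfl) (fun _ => rfl) fun c => by rw [c3]; simp
      have hval : (b i : ℕ) ≠ b (i + 1) := fun h => hbb (Fin.ext h.symm)
      simp only [run_ite, a9, a11, if_pos hbb]
      rcases hval.lt_or_gt with hlt | hlt
      · rw [if_pos hlt]
        refine hbd'.imp ?_
        rintro t s' ⟨c1, c2⟩
        exact ⟨by omega, c2⟩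
      · rw [if_neg hlt.not_gt, if_pos hlt]
        refine hbd'.imp ?_
        rintro t s' ⟨c1, c2⟩
        exact ⟨by omega, c2⟩
    · have hval : (b (i + 1) : ℕ) = b i := congrArg Fin.val (not_not.1 hbb)
      simp only [run_ite, a9, a11, hval, lt_irrefl, if_false, run_skip, if_neg hbb]
      refine ⟨by omega, ⟨fun _ _ => rfl, rfl⟩, D, len, pos, hl, ?_⟩
      rw [eagerStep, Nat.add_sub_cancel, if_neg hbb]
      exact hrel1
  rw [run_seq]
  refine mid.imp ?_
  rintro t2 s2 ⟨b1, b2, D', len', pos', b3, b4⟩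
  have hs2 : Consts n σ K s2 := hs1.of_eq fun r hr => b2.1 r (by omega)
  have b8 : s2.reg 8 = i + 1 := by rw [b2.1 8 (by norm_num), a1 8 (by norm_num), h8]
  simp only [run_seq, run_copy, run_add, State.set_reg, Nat.reduceEqDiff, ↓reduceIte, b8, hs2.r2]
  refine ⟨by omega, by omega, hs2.of_eq fun r hr => ?_, ?_, ?_, ?_, ?_, D', len', pos', b3, ?_⟩
  · have : r ≠ 8 ∧ r ≠ 9 ∧ r ≠ 10 := by omega
    simp [State.set_reg, this]
  · simp [State.set_reg]
  · simp [State.set_reg, b2.1 11 (by norm_num), a11]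
  · simp [State.set_reg, b2.1 13 (by norm_num), a13]
  · rw [State.set_inp, State.set_inp, State.set_inp, b2.2, ainp]
  · exact b4.congr (fun _ => rfl) (fun _ => rfl) fun c => by simp [State.set_reg]

theorem run_setup (hK : 2 ^ K < 2 * n) (hn : 2 ≤ n) (hW : 8 * n ≤ W) (hM : 8 * n ≤ M)
    (hσK : σ ≤ 2 ^ K) (hmin : ∀ k < K, 2 ^ k < σ) {s : State} (h0 : s.reg 0 = n)
    (h1 : s.reg 1 = σ) (h7 : s.reg 7 = 0) (hmem : ∀ a, s.mem a = 0) :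
    Run W M setup s (fun t s' => t ≤ 4 * K + 7 ∧ Consts n σ K s' ∧ s'.inp = s.inp ∧
      s'.out = s.out ∧ s'.reg 14 = s.reg 14 ∧
      Layout n K s'.mem (fun _ => 0) (fun _ => 0) (fun _ => 0)) := by
  simp only [setup, run_seq, run_const, run_add, State.set_reg, Nat.reduceEqDiff, ↓reduceIte, h0]
  refine ⟨by omega, by omega, by omega, by omega, by omega, by omega, ?_⟩
  let I : ℕ → State → Prop := fun h s' => s'.reg 0 = n ∧ s'.reg 1 = σ ∧ s'.reg 2 = 1 ∧
    s'.reg 3 = 2 ^ h ∧ s'.reg 4 = 2 * n ∧ s'.reg 5 = 6 * n ∧ s'.reg 6 = 7 * n ∧ s'.reg 7 = 0 ∧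
    s'.reg 14 = s.reg 14 ∧ s'.inp = s.inp ∧ s'.out = s.out ∧
    (∀ k < h, s'.mem (2 ^ (k + 1)) = 2 ^ k) ∧ ∀ a, 2 * n ≤ a → s'.mem a = 0
  refine (run_loop I (fun _ => 3) 0 K (Nat.zero_le _) ?_ ?_ ?_).imp ?_
  · rintro h s' - hh ⟨g0, g1, g2, g3, g4, g5, g6, g7, g14, gi, go, gh, gm⟩
    have hp := pow_succ_lt hK hh
    have hp2 : 2 ^ h + 2 ^ h = 2 ^ (h + 1) := by ring
    refine ⟨by rw [g1, g3]; exact hmin h hh, ?_⟩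
    simp only [run_seq, run_add, run_store, run_copy, State.set_reg, State.setMem_reg,
      Nat.reduceEqDiff, ↓reduceIte, g3, hp2]
    refine ⟨by omega, by omega, by omega, ?_⟩
    refine ⟨?_, ?_, ?_, ?_, ?_, ?_, ?_, ?_, ?_, gi, go, fun k hk => ?_, fun a ha => ?_⟩
    all_goals try simp only [State.set_reg, State.setMem_reg, Nat.reduceEqDiff, ↓reduceIte,
      g0, g1, g2, g4, g5, g6, g7, g14]
    all_goals simp only [State.set_mem, State.setMem_mem]
    · rcases (Nat.lt_succ_iff.1 hk).eq_or_lt with rfl | hk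
      · rw [Function.update_self]
      · rw [Function.update_of_ne, gh k hk]
        exact fun h' => absurd (Nat.pow_right_injective le_rfl h') (by omega)
    · rw [Function.update_of_ne (by omega), gm a ha]
  · rintro s' ⟨-, g1, -, g3, -⟩
    rw [g1, g3]
    omega
  · refine ⟨?_, ?_, ?_, ?_, ?_, ?_, ?_, ?_, ?_, rfl, rfl, fun k hk => ?_, fun a ha => hmem a⟩
    all_goals try simp only [State.set_reg, Nat.reduceEqDiff, ↓reduceIte, h0, h1, h7, pow_zero]
    all_goals omega
  · rintro t s' ⟨ht, g0, g1, g2, g3, g4, g5, g6, g7, g14, gi, go, gh, gm⟩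
    simp only [Finset.sum_const, Nat.card_Ico, smul_eq_mul] at ht
    exact ⟨by omega, ⟨g0, g1, g2, g3, g4, g5, g6, g7⟩, gi, go, g14, gh,
      fun v _ => gm _ (by omega), fun c _ => gm _ (by omega), fun c _ => gm _ (by omega)⟩

theorem run_finish (hf : Fits n K W M) (hσ : σ ≤ n) {s : State} (hs : Consts n σ K s)
    (hl : Layout n K s.mem D len pos) :
    Run W M finish s (fun t s' => t ≤ 6 * σ + 2 ∧
      s'.out = s.out ++ ((List.range σ).map pos).filter (fun x => 0 < x)) := by
  obtain ⟨hn, hK, hW, hM⟩ := hf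
  rw [finish, run_seq, run_const]
  refine ⟨by omega, ?_⟩
  let I : ℕ → State → Prop := fun j s' => (∀ r < 8, s'.reg r = s.reg r) ∧ s'.reg 8 = j ∧
    s'.mem = s.mem ∧ s'.out = s.out ++ ((List.range j).map pos).filter (fun x => 0 < x)
  refine (run_loop I (fun _ => 5) 0 σ (Nat.zero_le _) ?_ ?_ ?_).imp ?_
  · rintro j s' - hj ⟨g1, g2, g3, g4⟩
    have hs' := hs.of_eq g1
    have e1 : s'.mem (7 * n + j) = pos j := by rw [g3, hl.pos j (by omega)]
    have hsame : ∀ x < 8, x ≠ 8 ∧ x ≠ 18 ∧ x ≠ 19 := by omega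
    refine ⟨by rw [g2, hs'.r1]; exact hj, ?_⟩
    simp only [run_seq, run_add, run_load, run_ite, run_write, run_skip, State.set_reg,
      State.set_mem, Nat.reduceEqDiff, ↓reduceIte, g2, hs'.r2, hs'.r6, hs'.r7, e1]
    refine ⟨by omega, by omega, ?_⟩
    split_ifs with hp
    · refine ⟨by omega, by omega, fun r hr => ?_, ?_, g3, ?_⟩
      · simp [State.set_reg, hsame r hr, g1 r hr]
      · simp [State.set_reg]
      · simp only [State.set_out, g4, List.range_succ, List.map_append, List.filter_append]
        simp [hp]
    · refine ⟨by omega, by omega, fun r hr => ?_, ?_, g3, ?_⟩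
      · simp [State.set_reg, hsame r hr, g1 r hr]
      · simp [State.set_reg]
      · simp only [State.set_out, g4, List.range_succ, List.map_append, List.filter_append]
        simp [hp]
  · rintro s' ⟨g1, g2, -⟩
    rw [g2, (hs.of_eq g1).r1]
    omega
  · refine ⟨fun r hr => ?_, ?_, rfl, by simp [State.set_out]⟩
    · simp only [State.set_reg]
      rw [if_neg (by omega)]
    · simp [State.set_reg]
  · rintro t s' ⟨ht, -, -, -, g4⟩
    simp only [Finset.sum_const, Nat.card_Ico, smul_eq_mul] at ht
    exact ⟨by omega, g4⟩

end Program

/-! ### The running time -/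

section Time

theorem length_splitBy_loop {α : Type*} [DecidableEq α] (b : ℕ → α) (k m : ℕ) (g : List α)
    (gs : List (List α)) :
    (List.splitBy.loop (fun x y => x == y) ((List.range' (m + 1) k).map b) (b m) g gs).length =
      gs.length + 1 + ∑ i ∈ Finset.Ico (m + 1) (m + 1 + k), if b i ≠ b (i - 1) then 1 else 0 := by
  induction k generalizing m g gs with
  | zero => simp [List.splitBy.loop]
  | succ k ih =>
    rw [List.range'_succ, List.map_cons, Finset.sum_eq_sum_Ico_succ_bot (by omega),
      Nat.add_sub_cancel, List.splitBy.loop]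
    have hk : m + 1 + (k + 1) = m + 1 + 1 + k := by omega
    by_cases h : b m = b (m + 1)
    · simp only [h, beq_self_eq_true]
      rw [if_neg (by simp), hk, ih (m + 1)]
      omega
    · have h' : (b m == b (m + 1)) = false := by simpa using h
      simp only [h']
      rw [if_pos (fun h2 => h h2.symm), hk, ih (m + 1), List.length_cons]
      omega

theorem runs_map_range {α : Type*} [DecidableEq α] (b : ℕ → α) {n : ℕ} (hn : 0 < n) :
    runs ((List.range n).map b) =
      1 + ∑ i ∈ Finset.Ico 1 n, if b i ≠ b (i - 1) then 1 else 0 := by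
  obtain ⟨m, rfl⟩ : ∃ m, n = m + 1 := ⟨n - 1, by omega⟩
  rw [runs, List.range_eq_range', List.range'_succ, List.map_cons, List.splitBy,
    length_splitBy_loop b m 0 [] []]
  simp [add_comm m 1]

theorem run_onePassProg {σ K W M : ℕ} {T : List (Fin σ)} {b : ℕ → Fin σ} {L u : ℕ → ℕ}
    (hf : Fits T.length K W M) (hσ : σ ≤ T.length) (hσK : σ ≤ 2 ^ K) (hmin : ∀ k < K, 2 ^ k < σ)
    (h : IsArrays T b L u)
    (ha : arrays T = (List.range T.length).map (fun k => (b k, L k, u k))) (hL0 : L 0 < W) :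
    Run W M onePassProg (initState T) (fun t s =>
      t ≤ 4 * K + 6 * σ + 12 +
        ∑ i ∈ Finset.Ico 1 T.length, (12 + (if b i ≠ b (i - 1) then 36 * K + 58 else 0) + 1) ∧
      s.out.Nodup ∧ s.out.toFinset = onePass T) := by
  obtain ⟨hn, hK, hW, hM⟩ := id hf
  rw [onePassProg, run_seq]
  refine (run_setup hK hn hW hM hσK hmin (s := initState T) rfl rfl rfl (fun _ => rfl)).imp ?_
  rintro t1 s1 ⟨a1, hs1, ai, ao, a14, hl1⟩
  have hinp : s1.inp = ((b 0 : ℕ), L 0, u 0) ::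
      (List.range' 1 (T.length - 1)).map (fun k => ((b k : ℕ), L k, u k)) := by
    rw [ai, initState, ha, List.range_eq_range',
      show T.length = (T.length - 1) + 1 by omega, List.range'_succ]
    simp
  have hb0 := (b 0).2
  have hu0 := h.le_length 0 (by omega)
  rw [run_seq]
  refine run_read hinp (by omega) hL0 (by omega) ?_
  rw [run_seq, run_const]
  refine ⟨by omega, ?_⟩
  rw [run_seq]
  refine (run_loop (MainInv T.length σ K b L u)
    (fun i => 12 + (if b i ≠ b (i - 1) then 36 * K + 58 else 0)) 1 T.length (by omega) ?_ ?_
    ⟨hs1.of_eq fun r hr => ?_, ?_, ?_, ?_, by rfl, _, _, _, by exact hl1, ?_⟩).imp ?_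
  · intro i s h1 h2 h3
    refine ⟨by rw [h3.r8, h3.consts.r0]; exact h2, ?_⟩
    exact run_iteration hf hσ hσK (fun k => h.lcp_lt) h.one_le h.le_length h.inj (by omega) h2 h3
  · intro s h3
    rw [h3.r8, h3.consts.r0]
    omega
  · have : r ≠ 8 ∧ r ≠ 9 ∧ r ≠ 10 ∧ r ≠ 19 := by omega
    simp [State.set_reg, this]
  · simp [State.set_reg]
  · simp [State.set_reg]
  · simp [State.set_reg]
  · have hout : s1.out = [] := ao
    have h14 : s1.reg 14 = 0 := a14
    simp only [State.set_out, hout]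
    refine (lazyRel_init T.length).congr (fun _ => rfl) (fun _ => rfl) fun c => ?_
    simp [State.set_reg, h14, up_eq_zero]
  · rintro t2 s2 ⟨b1, b2⟩
    obtain ⟨D, len, pos, hl, hrel⟩ := b2.data
    refine (run_finish hf hσ b2.consts hl).imp ?_
    rintro t3 s3 ⟨c1, c2⟩
    have hfin := hrel.finish
    rw [c2, onePass_eq_eager b L ha]
    exact ⟨by omega, hfin.1, hfin.2⟩

theorem le_two_mul_logb {σ K : ℕ} (hσ : 2 ≤ σ) (hmin : ∀ k < K, 2 ^ k < σ) :
    (K : ℝ) ≤ 2 * Real.logb 2 σ := by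
  have hσ' : (2 : ℝ) ≤ σ := by exact_mod_cast hσ
  have h1 : (1 : ℝ) ≤ Real.logb 2 σ := by
    rw [Real.le_logb_iff_rpow_le (by norm_num) (by linarith), Real.rpow_one]
    exact hσ'
  rcases K with _ | k
  · simp only [Nat.cast_zero]; linarith
  · have h2 : (k : ℝ) ≤ Real.logb 2 σ := by
      rw [Real.le_logb_iff_rpow_le (by norm_num) (by linarith), Real.rpow_natCast]
      exact_mod_cast (hmin k (by omega)).le
    push_cast
    linarith

theorem onePass_run {σ : ℕ} {T : List (Fin σ)} (hT : IsText T) (hσ : σ ≤ T.length) :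
    IsSmallestSuffixient T (onePass T) ∧
      ∃ (t : ℕ) (s : State),
        Exec (250 * T.length) (250 * T.length) onePassProg (initState T) t s ∧
        s.out.Nodup ∧ s.out.toFinset = onePass T ∧
        (t : ℝ) ≤ 250 * (T.length + rBar T * Real.logb 2 σ) := by
  obtain ⟨b, L, u, h, ha, hb⟩ := exists_isArrays hT
  refine ⟨isSmallestSuffixient_onePass hT h ha, ?_⟩
  have hn := hT.1
  have hσ2 : 2 ≤ σ := by
    obtain ⟨-, v, d, rfl, -, hd⟩ := hT
    by_contra hlt
    have : Subsingleton (Fin σ) := by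
      rcases (show σ = 0 ∨ σ = 1 by omega) with rfl | rfl <;> infer_instance
    simp only [List.length_append, List.length_singleton] at hn
    have h0 : v[0] ∈ v := List.getElem_mem (by omega)
    exact hd (Subsingleton.elim v[0] d ▸ h0)
  have hσK : σ ≤ 2 ^ Nat.clog 2 σ := Nat.le_pow_clog (by norm_num) _
  have hmin : ∀ k < Nat.clog 2 σ, 2 ^ k < σ := fun k hk =>
    (Nat.lt_clog_iff_pow_lt (by norm_num)).1 hk
  set K := Nat.clog 2 σ with hK
  have hK0 : 0 < K := Nat.clog_pos (by norm_num) hσ2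
  have hKlt : 2 ^ K < 2 * T.length := by
    have := hmin (K - 1) (by omega)
    have h2 : 2 ^ K = 2 * 2 ^ (K - 1) := by
      rw [← pow_succ', Nat.sub_add_cancel hK0]
    omega
  have hL0 : L 0 = 0 := by
    have h1 : (arrays T)[0]? = some (b 0, L 0, u 0) := by
      rw [ha, List.getElem?_map, List.getElem?_range (by omega)]; rfl
    have h2 : ∀ x ∈ (arrays T)[0]?, x.2.1 = 0 := by
      intro x hx
      simp only [arrays, lcpArray] at hx
      rw [List.zip, List.getElem?_zipWith, List.zip, List.getElem?_zipWith] at hx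
      simp only [List.getElem?_cons_zero, Option.mem_def] at hx
      split at hx
      · rename_i h3
        split at h3
        · simp_all
          rw [← hx, ← h3]
        · simp at h3
      · simp at hx
    exact h2 _ h1
  obtain ⟨t, s, h1, h2, h3, h4⟩ := run_onePassProg (W := 250 * T.length) (M := 250 * T.length)
    ⟨hn, hKlt, by omega, by omega⟩ hσ hσK hmin h ha (by omega)
  refine ⟨t, s, h1, h3, h4, ?_⟩
  have hr : rBar T = 1 + ∑ i ∈ Finset.Ico 1 T.length, if b i ≠ b (i - 1) then 1 else 0 := by
    rw [rBar, hb, runs_map_range b (by omega)]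
  have hsum : ∑ i ∈ Finset.Ico 1 T.length,
      (12 + (if b i ≠ b (i - 1) then 36 * K + 58 else 0) + 1) =
      13 * (T.length - 1) +
        (36 * K + 58) * ∑ i ∈ Finset.Ico 1 T.length, if b i ≠ b (i - 1) then 1 else 0 := by
    rw [Finset.mul_sum, Finset.sum_add_distrib, Finset.sum_add_distrib]
    simp only [Finset.sum_const, Nat.card_Ico, smul_eq_mul, mul_ite, mul_one, mul_zero]
    ring
  have ht : t ≤ 31 * T.length + 94 * (rBar T * K) := by
    rw [hsum] at h2
    rw [hr]
    generalize (∑ i ∈ Finset.Ico 1 T.length, if b i ≠ b (i - 1) then 1 else 0) = r at h2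
    have e1 : (36 * K + 58) * r ≤ 94 * (K * r) := by
      have : r ≤ K * r := Nat.le_mul_of_pos_left r hK0
      calc (36 * K + 58) * r = 36 * (K * r) + 58 * r := by ring
        _ ≤ 94 * (K * r) := by omega
    have e2 : (1 + r) * K = K + K * r := by ring
    rw [e2]
    omega
  have hlog := le_two_mul_logb hσ2 hmin
  have ht' : (t : ℝ) ≤ 31 * T.length + 94 * (rBar T * K) := by exact_mod_cast ht
  have hmul : (rBar T : ℝ) * K ≤ rBar T * (2 * Real.logb 2 σ) :=
    mul_le_mul_of_nonneg_left hlog (Nat.cast_nonneg _)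
  have hpos : (0 : ℝ) ≤ rBar T * Real.logb 2 σ := by
    refine mul_nonneg (Nat.cast_nonneg _) ?_
    have : (0 : ℝ) ≤ K := Nat.cast_nonneg _
    linarith
  have hnn : (0 : ℝ) ≤ T.length := Nat.cast_nonneg _
  linarith

end Time

end Suffixient

theorem mainTheorem11 :
    ∃ (P : Suffixient.Prog) (C : ℕ), ∀ (σ : ℕ) (T : List (Fin σ)),
      Suffixient.IsText T → σ ≤ T.length →
        Suffixient.IsSmallestSuffixient T (Suffixient.onePass T) ∧
        ∃ (t : ℕ) (s : Suffixient.State),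
          Suffixient.Exec (C * T.length) (C * T.length) P (Suffixient.initState T) t s ∧
          s.out.Nodup ∧ s.out.toFinset = Suffixient.onePass T ∧
          (t : ℝ) ≤ C * (T.length + Suffixient.rBar T * Real.logb 2 σ) :=
  ⟨Suffixient.onePassProg, 250, fun _ _ hT hσ => by
    exact_mod_cast Suffixient.onePass_run hT hσ⟩
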